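/- Let $n\ge 2$. Let $\nu,\tau:[0,\infty)\to\mathbb R$ be continuous with $\tau>0$, $\nu(0)=0$, such that $k=\nu/\tau$ is increasing, and let $j$ be the inverse function of $k$. For $\kappa>0$ let $$c(\kappa)=\frac{\int_0^\pi\cos\theta\,e^{\kappa\cos\theta}\sin^{n-2}\theta\,d\theta}{\int_0^\pi e^{\kappa\cos\theta}\sin^{n-2}\theta\,d\theta},\qquad \widetilde c(\kappa)=\frac{\int_0^\pi\cos\theta\,h_\kappa(\cos\theta)e^{\kappa\cos\theta}\sin^{n}\theta\,d\theta}{\int_0^\pi h_\kappa(\cos\theta)e^{\kappa\cos\theta}\sin^{n}\theta\,d\theta},$$ where $h_\kappa(\cos\theta)=g_\kappa(\theta)/\sin\theta$ and $g_\kappa$ is the unique solution on $(0,\pi)$ of $$-\sin^{2-n}\theta\,e^{-\kappa\cos\theta}\big(\sin^{n-2}\theta\,e^{\kappa\cos\theta}g'(\theta)\big)'+\frac{n-2}{\sin^2\theta}g(\theta)=\sin\theta$$ in the space of functions $g$ with $(n-2)(\sin\theta)^{\frac n2-2}g\in L^2(0,\pi)$ and $(\sin\theta)^{\frac n2-1}g\in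 H^1_0(0,\pi)$. Let $\rho\mapsto\kappa(\rho)>0$, $\rho>\rho_0\ge 0$, be a branch of stable von Mises--Fisher equilibria, that is, a continuous function with $\frac{j}{c}(\kappa(\rho))=\rho$ and $\big(\frac jc\big)'(\kappa(\rho))>0$ for all $\rho>\rho_0$. The associated self-organized hydrodynamic (SOH) model, for a density $\rho(x,t)>0$ and an orientation $\Omega(x,t)\in\mathbb S^{n-1}$, is $$\partial_t\rho+\nabla_x\cdot(\rho c_1\Omega)=0,\qquad \rho\big(\partial_t\Omega+c_2(\Omega\cdot\nabla_x)\Omega\big)+\Theta\,P_{\Omega^\perp}\nabla_x\rho=\mathcal K_2\,\delta\,P_{\Omega^\perp}\Delta_x(\rho c_1\Omega),$$ where $\mathcal K_2\ge0$ is a constant, $\delta(\rho)=\frac{\nu(j)}{c}\big(\frac{n-1}{\kappa}+\widetilde c\big)$, $c_1(\rho)=c(\kappa(\rho))$, $c_2(\rho)=\widetilde c(\kappa(\rho))$ and $$\Theta(\rho)=\frac1\kappa+(\widetilde c(\kappa)-c(\kappa))\,\frac{\rho}{\kappa}\,\frac{d\kappa}{d\rho},\qquad \kappa=\kappa(\rho).$$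 It is called hyperbolic at the density $\rho$ if, for every $\Omega\in\mathbb S^{n-1}$ and every direction $\xi\in\mathbb R^n$, the symbol of its first-order part (the left-hand sides) in the direction $\xi$ at the state $(\rho,\Omega)$, acting on the tangent space $\mathbb R\times\Omega^\perp$, is diagonalizable over $\mathbb R$. Suppose that, for some $a,b>0$, $k(|J|)\sim a|J|^b$ and $k'(|J|)\sim ab|J|^{b-1}$ as $|J|\to\infty$. Then: (i) If $0<b<1$, then for $\rho$ sufficiently large $\Theta(\rho)>0$ and the SOH model is hyperbolic at $\rho$. (ii) If $b>1$, then for $\rho$ sufficiently large $\Theta(\rho)<0$ and the SOH model is not hyperbolic at $\rho$. (iii) If $b=1$ and moreover $k(|J|)=a|J|+r+o(1)$ and $k'(|J|)=a+o(|J|^{-1})$ as $|J|\to\infty$, with $r\ne\frac{n+1}6$, then for $\rho$ sufficiently large $\Theta(\rho)$ has the sign of $r-\frac{n+1}6$. -/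

import Mathlib

open MeasureTheory Filter Asymptotics
open scoped Topology

noncomputable section

namespace SOH

/-! ### The alignment model and its von Mises-Fisher equilibria -/

/-- The ratio `k(|J|) = ν(|J|) / τ(|J|)` of the alignment frequency and the noise intensity. -/
def ratio (ν τ : ℝ → ℝ) (s : ℝ) : ℝ := ν s / τ s

/-- Standing assumptions on the alignment frequency `ν` and the noise intensity `τ`, as functions
of `|J| ∈ [0, ∞)`: they are continuous, `τ > 0`, `ν` vanishes at `0` (no alignment force when the
mean current vanishes), and `k = ν / τ` is increasing. -/
structure IsModel (ν τ : ℝ → ℝ) : Prop where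
  continuous_nu : ContinuousOn ν (Set.Ici 0)
  continuous_tau : ContinuousOn τ (Set.Ici 0)
  tau_pos : ∀ s, 0 ≤ s → 0 < τ s
  nu_zero : ν 0 = 0
  ratio_increasing : StrictMonoOn (ratio ν τ) (Set.Ici 0)

/-- The order parameter `c(κ)` of the von Mises-Fisher distribution with concentration `κ` on the
unit sphere of `ℝⁿ`, `n ≥ 2`. -/
def orderParam (n : ℕ) (κ : ℝ) : ℝ :=
  (∫ θ in (0 : ℝ)..Real.pi, Real.cos θ * Real.exp (κ * Real.cos θ) * Real.sin θ ^ (n - 2)) /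
    ∫ θ in (0 : ℝ)..Real.pi, Real.exp (κ * Real.cos θ) * Real.sin θ ^ (n - 2)

/-- The inverse function `j` of `k : [0, ∞) → ℝ`. -/
def inverse (k : ℝ → ℝ) : ℝ → ℝ := Function.invFunOn k (Set.Ici 0)

/-- `κ` is, for the densities `ρ > ρ₀`, a branch of positive solutions of the compatibility
equation `j(κ) / c(κ) = ρ`, all of which are stable, i.e. satisfy `(j / c)' (κ(ρ)) > 0`. -/
structure IsStableBranch (n : ℕ) (k : ℝ → ℝ) (ρ₀ : ℝ) (κ : ℝ → ℝ) : Prop where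
  nonneg : 0 ≤ ρ₀
  continuous : ContinuousOn κ (Set.Ioi ρ₀)
  pos : ∀ ρ, ρ₀ < ρ → 0 < κ ρ
  compatibility : ∀ ρ, ρ₀ < ρ → inverse k (κ ρ) / orderParam n (κ ρ) = ρ
  stable : ∀ ρ, ρ₀ < ρ → 0 < deriv (fun x => inverse k x / orderParam n x) (κ ρ)

/-! ### The generalized collisional invariants -/

/-- `u ∈ L²(0, π)`. -/
def MemL2 (u : ℝ → ℝ) : Prop := MemLp u 2 (volume.restrict (Set.Ioo 0 Real.pi))

/-- `u ∈ H¹₀(0, π)`, for a function `u` which is `C¹` on the open interval `(0, π)`. -/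
structure MemH10 (u : ℝ → ℝ) : Prop where
  memL2 : MemL2 u
  memL2_deriv : MemL2 (deriv u)
  tendsto_zero : Tendsto u (𝓝[>] 0) (𝓝 0)
  tendsto_pi : Tendsto u (𝓝[<] Real.pi) (𝓝 0)

/-- Membership in the space
`V = {g | (n-2) (sin θ)^(n/2-2) g ∈ L²(0,π), (sin θ)^(n/2-1) g ∈ H¹₀(0,π)}`
(for functions `g` which are `C¹` on `(0, π)`). -/
structure MemV (n : ℕ) (g : ℝ → ℝ) : Prop where
  memL2 : MemL2 fun θ => ((n : ℝ) - 2) * Real.sin θ ^ ((n : ℝ) / 2 - 2) * g θ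
  memH10 : MemH10 fun θ => Real.sin θ ^ ((n : ℝ) / 2 - 1) * g θ

/-- The differential operator
`g ↦ - sin^(2-n) θ e^(-κ cos θ) d/dθ (sin^(n-2) θ e^(κ cos θ) g'(θ)) + (n-2) / sin² θ g(θ)`. -/
def ellipticOp (n : ℕ) (κ : ℝ) (g : ℝ → ℝ) (θ : ℝ) : ℝ :=
  -(deriv (fun t => Real.sin t ^ (n - 2) * Real.exp (κ * Real.cos t) * deriv g t) θ /
      (Real.sin θ ^ (n - 2) * Real.exp (κ * Real.cos θ))) +
    ((n : ℝ) - 2) / Real.sin θ ^ 2 * g θ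

/-- `g` solves `ellipticOp n κ g = sin` on `(0, π)` and belongs to the space `V`. By elliptic
regularity, solutions are smooth in the open interval. -/
structure IsGCI (n : ℕ) (κ : ℝ) (g : ℝ → ℝ) : Prop where
  smooth : ContDiffOn ℝ 2 g (Set.Ioo 0 Real.pi)
  memV : MemV n g
  equation : ∀ θ ∈ Set.Ioo 0 Real.pi, ellipticOp n κ g θ = Real.sin θ

/-- The solution `g_κ ∈ V` of the elliptic problem (unique on `(0, π)`). -/
def gciG (n : ℕ) (κ : ℝ) : ℝ → ℝ := Classical.epsilon (IsGCI n κ)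

/-- The function `h_κ` on `[-1, 1]` with `h_κ(cos θ) = g_κ(θ) / sin θ`. -/
def gciH (n : ℕ) (κ μ : ℝ) : ℝ := gciG n κ (Real.arccos μ) / Real.sin (Real.arccos μ)

/-- The coefficient `c̃(κ)`. -/
def cTilde (n : ℕ) (κ : ℝ) : ℝ :=
  (∫ θ in (0 : ℝ)..Real.pi,
      Real.cos θ * gciH n κ (Real.cos θ) * Real.exp (κ * Real.cos θ) * Real.sin θ ^ n) /
    ∫ θ in (0 : ℝ)..Real.pi,
      gciH n κ (Real.cos θ) * Real.exp (κ * Real.cos θ) * Real.sin θ ^ n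

/-! ### The self-organized hydrodynamic model

For a branch `ρ ↦ κ(ρ)` the model reads, for a density `ρ(x,t) > 0` and an orientation
`Ω(x,t)` in the unit sphere,

`∂ₜρ + ∇·(ρ c₁ Ω) = 0`,
`ρ (∂ₜΩ + c₂ (Ω·∇) Ω) + Θ P ∇ρ = K δ P Δ(ρ c₁ Ω)`,

with `P` the orthogonal projection onto `Ω^⊥` and `c₁, c₂, Θ, δ` functions of `ρ`. The right-hand
side of the second equation does not enter the first-order part of the system. -/

/-- `c₁(ρ) = c(κ(ρ))`. -/
def coeff1 (n : ℕ) (κ : ℝ → ℝ) (ρ : ℝ) : ℝ := orderParam n (κ ρ)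

/-- `c₂(ρ) = c̃(κ(ρ))`. -/
def coeff2 (n : ℕ) (κ : ℝ → ℝ) (ρ : ℝ) : ℝ := cTilde n (κ ρ)

/-- `Θ(ρ) = 1/κ + (c̃ - c) (ρ/κ) dκ/dρ`. -/
def Theta (n : ℕ) (κ : ℝ → ℝ) (ρ : ℝ) : ℝ :=
  1 / κ ρ + (cTilde n (κ ρ) - orderParam n (κ ρ)) * (ρ / κ ρ) * deriv κ ρ

/-- The symbol, in the direction `ξ` and at the state `(ρ, Ω)`, of the first-order part
`∂ₜρ + (ρ c₁)'(ρ) Ω·∇ρ + ρ c₁ ∇·Ω`, `∂ₜΩ + c₂ (Ω·∇)Ω + (Θ/ρ) P ∇ρ`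
of the model. It acts on the tangent space `ℝ × Ω^⊥` of the state space `(0,∞) × 𝕊`: one replaces
`∇ρ` by `r ξ` and `∂_i Ω` by `ξ_i w`, for `r ∈ ℝ` and `w ∈ Ω^⊥`. -/
def symbol (n : ℕ) (κ : ℝ → ℝ) (ρ : ℝ) (Ω ξ : EuclideanSpace ℝ (Fin n)) :
    Module.End ℝ (ℝ × (Submodule.span ℝ {Ω})ᗮ) where
  toFun u :=
    (deriv (fun x => x * coeff1 n κ x) ρ * inner ℝ Ω ξ * u.1 +
        ρ * coeff1 n κ ρ * inner ℝ ξ (u.2 : EuclideanSpace ℝ (Fin n)),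
      (coeff2 n κ ρ * inner ℝ Ω ξ) • u.2 +
        (Theta n κ ρ / ρ * u.1) • (Submodule.span ℝ {Ω})ᗮ.orthogonalProjectionOnto ξ)
  map_add' u v := by
    ext1
    · simp only [Prod.fst_add, Prod.snd_add, Submodule.coe_add, inner_add_right]
      ring
    · simp only [Prod.fst_add, Prod.snd_add, mul_add, add_smul, smul_add]
      abel
  map_smul' a u := by
    ext1
    · simp only [Prod.smul_fst, Prod.smul_snd, Submodule.coe_smul, inner_smul_right, smul_eq_mul,
        RingHom.id_apply]
      ring
    · simp only [Prod.smul_fst, Prod.smul_snd, smul_eq_mul, RingHom.id_apply, smul_add, smul_smul]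
      congr 2 <;> ring

/-- The model is hyperbolic at the density `ρ`: for every orientation `Ω` and every direction `ξ`
the symbol is diagonalizable over `ℝ`, i.e. its (real) eigenspaces span. -/
def IsHyperbolicAt (n : ℕ) (κ : ℝ → ℝ) (ρ : ℝ) : Prop :=
  ∀ Ω ξ : EuclideanSpace ℝ (Fin n), ‖Ω‖ = 1 →
    ⨆ μ : ℝ, (symbol n κ ρ Ω ξ).eigenspace μ = ⊤

end SOH

end

/-! Differentiating `j(κ(ρ)) / c(κ(ρ)) = ρ` gives `1 / κ'(ρ) = ρ D` with `D = j'/j - c'/c`, and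
stability says `D > 0`. Hence `Θ = (D + c̃ - c) / (κ D)` has the sign of `j'/j - c'/c + c̃ - c` at
`κ(ρ)`, which is `thetaNumerator`. Since `κ(ρ) → ∞`, only expansions at large concentration matter.

Write `n = m + 2`. As `x → ∞`, `x j'/j → 1/b`, `x² c' → (m + 1)/2`, and `x² (c̃ - c) = -x + m/3 +
o(1)`. So `x * thetaNumerator → 1/b - 1`, which settles `b ≠ 1`. For `b = 1` the leading terms
cancel; the affine hypotheses give `x² j'/j = x + r + o(1)`, and the next order is `r - (m + 1)/2 +
m/3 = r - (m + 3)/6`.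

The expansion of `c` comes from a three-term recurrence for moments of `1 - cos θ`. For `c̃`, `g_κ`
is squeezed between an explicit subsolution and supersolution (`IsGCI.lower_le`, `IsGCI.le_upper`),
close enough to determine `1 - c̃` up to `o(x⁻²)` (`tendsto_mul_mul_one_sub_cTilde`). The comparison
is a maximum principle adapted to the space `V` (`nonneg_of_ellipticVal_nonneg`). Since `gciG` is a
choice, a solution must be shown to exist: power series at the two poles are glued at the equator
(`exists_isRegularSol`). Uniqueness is not needed, as the bounds hold for every solution.

For hyperbolicity, the symbol is a block operator whose coupling has the sign of `c₁ Θ`. If this is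
positive, its quadratic factor has distinct real roots whenever the coupling vector is nonzero; if
negative, a direction `ξ ⊥ Ω` yields `μ² = c₁ Θ < 0`. -/

namespace SOH

/-! ### Moments of `1 - cos θ` for the von Mises-Fisher distribution -/

/-- The moment `∫ (1 - cos θ)ᵏ sinᵐ θ e^(x cos θ) dθ` over `(0, π)`. -/
noncomputable def moment (m k : ℕ) (x : ℝ) : ℝ :=
  ∫ θ in (0 : ℝ)..Real.pi,
    (1 - Real.cos θ) ^ k * Real.sin θ ^ m * Real.exp (x * Real.cos θ)

theorem intervalIntegrable_moment (m k : ℕ) (x a b : ℝ) :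
    IntervalIntegrable (fun θ => (1 - Real.cos θ) ^ k * Real.sin θ ^ m * Real.exp (x * Real.cos θ))
      volume a b :=
  Continuous.intervalIntegrable (by fun_prop) _ _

theorem one_sub_cos_pos {θ : ℝ} (hθ : θ ∈ Set.Ioo 0 Real.pi) : 0 < 1 - Real.cos θ := by
  have := Real.cos_lt_cos_of_nonneg_of_le_pi le_rfl hθ.2.le hθ.1
  rw [Real.cos_zero] at this
  linarith

theorem moment_pos (m k : ℕ) (x : ℝ) : 0 < moment m k x := by
  refine intervalIntegral.intervalIntegral_pos_of_pos_on (intervalIntegrable_moment m k x _ _)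
    (fun θ hθ => ?_) Real.pi_pos
  have h1 := one_sub_cos_pos hθ
  have h2 := Real.sin_pos_of_mem_Ioo hθ
  positivity

/-- Integration by parts: the derivative of `sin^(m+1) θ (1 - cos θ)^k e^(x cos θ)` integrates to
zero since the sine vanishes at both ends, and `sin² = (1 - cos)(1 + cos)` expresses it through
three consecutive moments. -/
theorem moment_recurrence (m k : ℕ) (x : ℝ) :
    (2 * x + m + 1 + k) * moment m (k + 1) x =
      (m + 1 + 2 * k) * moment m k x + x * moment m (k + 2) x := by
  have hd : ∀ θ ∈ Set.uIcc 0 Real.pi, HasDerivAt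
      (fun θ => Real.sin θ ^ (m + 1) * (1 - Real.cos θ) ^ k * Real.exp (x * Real.cos θ))
      ((m + 1 + 2 * k) * ((1 - Real.cos θ) ^ k * Real.sin θ ^ m * Real.exp (x * Real.cos θ))
        + x * ((1 - Real.cos θ) ^ (k + 2) * Real.sin θ ^ m * Real.exp (x * Real.cos θ))
        - (2 * x + m + 1 + k) *
          ((1 - Real.cos θ) ^ (k + 1) * Real.sin θ ^ m * Real.exp (x * Real.cos θ))) θ := by
    intro θ _
    have h1 := (Real.hasDerivAt_sin θ).pow (m + 1)
    have h2 := ((Real.hasDerivAt_cos θ).const_sub 1).pow k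
    have h3 := ((Real.hasDerivAt_cos θ).const_mul x).exp
    have h4 := (h1.mul h2).mul h3
    refine h4.congr_deriv ?_
    have hk : (k : ℝ) * (1 - Real.cos θ) ^ (k - 1) * (1 - Real.cos θ) =
        k * (1 - Real.cos θ) ^ k := by
      cases k with
      | zero => simp
      | succ k => simp [pow_succ, mul_assoc]
    have hs : Real.sin θ ^ 2 = (1 - Real.cos θ) * (1 + Real.cos θ) := by
      rw [Real.sin_sq]; ring
    simp only [Pi.mul_apply, Pi.pow_apply]
    push_cast
    simp only [neg_neg]
    linear_combination (Real.exp (x * Real.cos θ) * Real.sin θ ^ m * k *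
      (1 - Real.cos θ) ^ (k - 1) - x * (1 - Real.cos θ) ^ k * Real.sin θ ^ m *
      Real.exp (x * Real.cos θ)) * hs +
      Real.exp (x * Real.cos θ) * Real.sin θ ^ m * (1 + Real.cos θ) * hk
  have hint := intervalIntegral.integral_eq_sub_of_hasDerivAt hd
    (Continuous.intervalIntegrable (by fun_prop) _ _)
  rw [intervalIntegral.integral_sub (Continuous.intervalIntegrable (by fun_prop) _ _)
    (Continuous.intervalIntegrable (by fun_prop) _ _),
    intervalIntegral.integral_add (Continuous.intervalIntegrable (by fun_prop) _ _)
    (Continuous.intervalIntegrable (by fun_prop) _ _)] at hint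
  simp only [intervalIntegral.integral_const_mul, Real.sin_pi, Real.sin_zero] at hint
  simp only [moment]
  simp only [ne_eq, Nat.succ_ne_zero, not_false_eq_true, zero_pow, zero_mul, sub_zero] at hint
  linarith

/-- Linear growth is far from sharp but suffices: on `[0, π/3]` the cosine is at least `1/2`, so the
exponential is at least `x/2`. -/
theorem exists_moment_lower_bound (m k : ℕ) :
    ∃ c > 0, ∀ x, 0 ≤ x → c * x ≤ moment m k x := by
  set c : ℝ := ∫ θ in (0 : ℝ)..(Real.pi / 3), (1 - Real.cos θ) ^ k * Real.sin θ ^ m with hc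
  have hpi := Real.pi_pos
  have hcpos : 0 < c := by
    refine intervalIntegral.intervalIntegral_pos_of_pos_on
      (Continuous.intervalIntegrable (by fun_prop) _ _) (fun θ hθ => ?_) (by positivity)
    have hθ' : θ ∈ Set.Ioo 0 Real.pi := ⟨hθ.1, by linarith [hθ.2]⟩
    have h1 := one_sub_cos_pos hθ'
    have h2 := Real.sin_pos_of_mem_Ioo hθ'
    positivity
  refine ⟨c / 2, by positivity, fun x hx => ?_⟩
  have h1 : ∫ θ in (0 : ℝ)..(Real.pi / 3),
      (1 - Real.cos θ) ^ k * Real.sin θ ^ m * Real.exp (x * Real.cos θ) ≤ moment m k x := by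
    refine intervalIntegral.integral_mono_interval le_rfl (by positivity) (by linarith) ?_
      (intervalIntegrable_moment m k x _ _)
    refine (ae_restrict_iff' measurableSet_Ioc).mpr (Eventually.of_forall fun θ hθ => ?_)
    have h1 := Real.cos_le_one θ
    have h2 := Real.sin_nonneg_of_nonneg_of_le_pi hθ.1.le hθ.2
    have h3 : 0 ≤ 1 - Real.cos θ := by linarith
    simp only [Pi.zero_apply]
    positivity
  have h2 : (x / 2) * c ≤ ∫ θ in (0 : ℝ)..(Real.pi / 3),
      (1 - Real.cos θ) ^ k * Real.sin θ ^ m * Real.exp (x * Real.cos θ) := by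
    rw [hc, ← intervalIntegral.integral_const_mul]
    refine intervalIntegral.integral_mono_on (by positivity)
      (Continuous.intervalIntegrable (by fun_prop) _ _) (intervalIntegrable_moment m k x _ _)
      fun θ hθ => ?_
    have h1 := Real.cos_le_one θ
    have h2 := Real.sin_nonneg_of_nonneg_of_le_pi hθ.1 (by linarith [hθ.2])
    have h3 : 0 ≤ 1 - Real.cos θ := by linarith
    have h4 : 1 / 2 ≤ Real.cos θ := by
      rw [← Real.cos_pi_div_three]
      exact Real.cos_le_cos_of_nonneg_of_le_pi hθ.1 (by linarith) hθ.2
    have h5 : x / 2 ≤ Real.exp (x * Real.cos θ) := by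
      have := Real.add_one_le_exp (x * Real.cos θ)
      nlinarith
    rw [mul_comm]
    gcongr
  linarith

/-- In the recurrence, `x * moment m (k + 2)` competes with `2 * x * moment m (k + 1)`. The
difference of these two moments is bounded above because `-cos θ * e^(x cos θ) ≤ 1`, and `x` times a
constant is absorbed by the linear lower bound on `moment m k`. -/
theorem exists_moment_succ_le (m k : ℕ) :
    ∃ C, 0 ≤ C ∧ ∀ x, 0 ≤ x → x * moment m (k + 1) x ≤ C * moment m k x := by
  obtain ⟨c, hc, hcx⟩ := exists_moment_lower_bound m k
  refine ⟨m + 1 + 2 * k + 2 ^ (k + 1) * Real.pi / c, by positivity, fun x hx => ?_⟩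
  have hrec := moment_recurrence m k x
  have hpos := moment_pos m (k + 1) x
  have htail : moment m (k + 2) x - moment m (k + 1) x ≤ 2 ^ (k + 1) * Real.pi := by
    rw [moment, moment, ← intervalIntegral.integral_sub (intervalIntegrable_moment _ _ _ _ _)
      (intervalIntegrable_moment _ _ _ _ _)]
    have : (2 : ℝ) ^ (k + 1) * Real.pi = ∫ _ in (0 : ℝ)..Real.pi, (2 : ℝ) ^ (k + 1) := by
      simp [mul_comm]
    rw [this]
    refine intervalIntegral.integral_mono_on Real.pi_pos.le
      (Continuous.intervalIntegrable (by fun_prop) _ _)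
      (Continuous.intervalIntegrable (by fun_prop) _ _) fun θ hθ => ?_
    have h1 := Real.cos_le_one θ
    have h1' := Real.neg_one_le_cos θ
    have h2 := Real.sin_nonneg_of_nonneg_of_le_pi hθ.1 hθ.2
    have h2' : Real.sin θ ^ m ≤ 1 := pow_le_one₀ h2 (Real.sin_le_one θ)
    have h3 : 0 ≤ 1 - Real.cos θ := by linarith
    have h4 : (1 - Real.cos θ) ^ (k + 1) ≤ 2 ^ (k + 1) := by
      gcongr
      linarith
    have h5 : -Real.cos θ * Real.exp (x * Real.cos θ) ≤ 1 := by
      rcases le_total 0 (Real.cos θ) with h | h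
      · nlinarith [Real.exp_pos (x * Real.cos θ)]
      · have : Real.exp (x * Real.cos θ) ≤ 1 := Real.exp_le_one_iff.mpr (by nlinarith)
        nlinarith [Real.exp_pos (x * Real.cos θ)]
    calc _ = (1 - Real.cos θ) ^ (k + 1) * Real.sin θ ^ m *
          (-Real.cos θ * Real.exp (x * Real.cos θ)) := by ring
      _ ≤ (1 - Real.cos θ) ^ (k + 1) * Real.sin θ ^ m * 1 := by gcongr
      _ ≤ 2 ^ (k + 1) * 1 * 1 := by gcongr
      _ = 2 ^ (k + 1) := by ring
  have h6 : x * (2 ^ (k + 1) * Real.pi) ≤ 2 ^ (k + 1) * Real.pi / c * moment m k x := by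
    have := hcx x hx
    calc _ = 2 ^ (k + 1) * Real.pi / c * (c * x) := by field_simp
      _ ≤ _ := by gcongr
  have h7 : x * (moment m (k + 2) x - moment m (k + 1) x) ≤ x * (2 ^ (k + 1) * Real.pi) := by
    gcongr
  have h8 : 0 ≤ (m + 1 + k : ℝ) * moment m (k + 1) x := by positivity
  linarith

/-- The ratio of two consecutive moments. -/
noncomputable def momentRatio (m k : ℕ) (x : ℝ) : ℝ := moment m (k + 1) x / moment m k x

theorem momentRatio_pos (m k : ℕ) (x : ℝ) : 0 < momentRatio m k x :=
  div_pos (moment_pos _ _ _) (moment_pos _ _ _)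

theorem moment_succ (m k : ℕ) (x : ℝ) :
    moment m (k + 1) x = momentRatio m k x * moment m k x :=
  (div_mul_cancel₀ _ (moment_pos _ _ _).ne').symm

theorem momentRatio_recurrence (m k : ℕ) (x : ℝ) :
    (2 * x + m + 1 + k) * momentRatio m k x =
      (m + 1 + 2 * k) + x * momentRatio m k x * momentRatio m (k + 1) x := by
  have h := moment_recurrence m k x
  rw [show k + 2 = (k + 1) + 1 from rfl, moment_succ m (k + 1), moment_succ m k] at h
  have hp := (moment_pos m k x).ne'
  apply mul_right_cancel₀ hp
  linear_combination h

theorem tendsto_momentRatio (m k : ℕ) : Tendsto (momentRatio m k) atTop (𝓝 0) := by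
  obtain ⟨C, -, hC⟩ := exists_moment_succ_le m k
  refine squeeze_zero' (Eventually.of_forall fun x => (momentRatio_pos m k x).le) ?_
    (tendsto_const_nhds (x := C) |>.div_atTop tendsto_id)
  filter_upwards [eventually_gt_atTop 0] with x hx
  rw [id, le_div_iff₀ hx, momentRatio, div_mul_eq_mul_div, div_le_iff₀ (moment_pos _ _ _)]
  linarith [hC x hx.le]

/-- With `R_k` the ratio, the recurrence reads `x R_k (2 - R_{k+1}) = (m + 1 + 2k) - (m + 1 + k)
R_k`, and all ratios tend to `0`. -/
theorem tendsto_mul_momentRatio (m k : ℕ) :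
    Tendsto (fun x => x * momentRatio m k x) atTop (𝓝 ((m + 1 + 2 * k) / 2)) := by
  have h0 := tendsto_momentRatio m k
  have h1 := tendsto_momentRatio m (k + 1)
  have h2 : Tendsto (fun x => ((m + 1 + 2 * k : ℝ) - (m + 1 + k) * momentRatio m k x) /
      (2 - momentRatio m (k + 1) x)) atTop
      (𝓝 (((m + 1 + 2 * k : ℝ) - (m + 1 + k) * 0) / (2 - 0))) :=
    (tendsto_const_nhds.sub (h0.const_mul _)).div (tendsto_const_nhds.sub h1) (by norm_num)
  rw [mul_zero, sub_zero, sub_zero] at h2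
  refine h2.congr' ?_
  filter_upwards [h1.eventually (gt_mem_nhds (show (0 : ℝ) < 1 by norm_num))] with x hx
  rw [div_eq_iff (by linarith)]
  linear_combination -momentRatio_recurrence m k x

/-- By the recurrence this quantity equals `(x R_k) (x R_{k+1} - (m + 1 + k)) / 2`, so the
first-order limits already give the second-order term. -/
theorem tendsto_mul_mul_momentRatio_sub (m k : ℕ) :
    Tendsto (fun x => x * (x * momentRatio m k x - (m + 1 + 2 * k) / 2)) atTop
      (𝓝 ((m + 1 + 2 * k) * (1 - m) / 8)) := by
  have h0 := tendsto_mul_momentRatio m k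
  have h1 := tendsto_mul_momentRatio m (k + 1)
  have h2 := ((h0.const_mul (-(m + 1 + k : ℝ))).add (h0.mul h1)).div_const 2
  refine (h2.congr fun x => ?_).trans (le_of_eq ?_)
  · linear_combination (-x / 2) * momentRatio_recurrence m k x
  · push_cast
    congr 1
    ring

/-! ### The order parameter and its derivative at large concentration. -/

theorem orderParam_eq (m : ℕ) (x : ℝ) : orderParam (m + 2) x = 1 - momentRatio m 0 x := by
  have hnum : ∫ θ in (0 : ℝ)..Real.pi,
      Real.cos θ * Real.exp (x * Real.cos θ) * Real.sin θ ^ m = moment m 0 x - moment m 1 x := by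
    rw [moment, moment, ← intervalIntegral.integral_sub (intervalIntegrable_moment _ _ _ _ _)
      (intervalIntegrable_moment _ _ _ _ _)]
    congr 1 with θ
    ring
  have hden : ∫ θ in (0 : ℝ)..Real.pi, Real.exp (x * Real.cos θ) * Real.sin θ ^ m =
      moment m 0 x := by
    rw [moment]
    congr 1 with θ
    ring
  rw [orderParam, Nat.add_sub_cancel, hnum, hden, sub_div, div_self (moment_pos _ _ _).ne',
    momentRatio]

theorem hasDerivAt_moment (m k : ℕ) (x : ℝ) :
    HasDerivAt (moment m k) (moment m k x - moment m (k + 1) x) x := by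
  have h := intervalIntegral.hasDerivAt_integral_of_dominated_loc_of_deriv_le (𝕜 := ℝ)
    (μ := volume) (a := 0) (b := Real.pi) (x₀ := x) (s := Metric.ball x 1)
    (bound := fun _ => 2 ^ k * Real.exp (|x| + 1))
    (F := fun x θ => (1 - Real.cos θ) ^ k * Real.sin θ ^ m * Real.exp (x * Real.cos θ))
    (F' := fun x θ => (1 - Real.cos θ) ^ k * Real.sin θ ^ m *
      (Real.exp (x * Real.cos θ) * Real.cos θ))
    (Metric.ball_mem_nhds x one_pos)
    (Eventually.of_forall fun y => Continuous.aestronglyMeasurable (by fun_prop))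
    (intervalIntegrable_moment m k x _ _)
    (Continuous.aestronglyMeasurable (by fun_prop))
    (Eventually.of_forall fun θ _ y hy => ?_) intervalIntegrable_const
    (Eventually.of_forall fun θ _ y _ => ?_)
  · refine h.2.congr_deriv ?_
    rw [moment, moment, ← intervalIntegral.integral_sub (intervalIntegrable_moment _ _ _ _ _)
      (intervalIntegrable_moment _ _ _ _ _)]
    congr 1 with θ
    ring
  · have hc := Real.abs_cos_le_one θ
    have h1 : |1 - Real.cos θ| ≤ 2 := by
      rw [abs_le] at hc ⊢
      constructor <;> linarith
    have hy' : |y| ≤ |x| + 1 := by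
      rw [Metric.mem_ball, Real.dist_eq] at hy
      have := abs_sub_abs_le_abs_sub y x
      linarith
    have h2 : y * Real.cos θ ≤ |x| + 1 := by
      calc y * Real.cos θ ≤ |y * Real.cos θ| := le_abs_self _
        _ = |y| * |Real.cos θ| := abs_mul _ _
        _ ≤ |y| * 1 := by gcongr
        _ ≤ |x| + 1 := by linarith
    rw [Real.norm_eq_abs, abs_mul, abs_mul, abs_mul, abs_pow, abs_pow, Real.abs_exp]
    calc _ ≤ 2 ^ k * 1 ^ m * (Real.exp (|x| + 1) * 1) := by
          gcongr
          exact Real.abs_sin_le_one θ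
      _ = _ := by ring
  · exact (((hasDerivAt_id y).mul_const (Real.cos θ)).exp.const_mul _).congr_deriv (by simp)

theorem hasDerivAt_orderParam (m : ℕ) (x : ℝ) :
    HasDerivAt (orderParam (m + 2))
      (momentRatio m 0 x * momentRatio m 1 x - momentRatio m 0 x ^ 2) x := by
  have h := ((hasDerivAt_moment m 1 x).div (hasDerivAt_moment m 0 x)
    (moment_pos m 0 x).ne').const_sub 1
  have hf : orderParam (m + 2) = fun x => 1 - (moment m 1 / moment m 0) x := by
    funext y
    exact orderParam_eq m y
  rw [hf]
  refine h.congr_deriv ?_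
  have hp := (moment_pos m 0 x).ne'
  rw [show 1 + 1 = 2 from rfl, show 0 + 1 = 1 from rfl,
    show moment m 2 x = momentRatio m 1 x * moment m 1 x from moment_succ m 1 x,
    show moment m 1 x = momentRatio m 0 x * moment m 0 x from moment_succ m 0 x]
  field_simp
  ring

theorem tendsto_orderParam (m : ℕ) : Tendsto (orderParam (m + 2)) atTop (𝓝 1) := by
  have := (tendsto_momentRatio m 0).const_sub 1
  rw [sub_zero] at this
  exact this.congr fun x => (orderParam_eq m x).symm

theorem tendsto_sq_mul_deriv_orderParam (m : ℕ) :
    Tendsto (fun x => x ^ 2 * deriv (orderParam (m + 2)) x) atTop (𝓝 ((m + 1) / 2)) := by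
  have h0 := tendsto_mul_momentRatio m 0
  have h1 := tendsto_mul_momentRatio m 1
  refine (((h0.mul h1).sub (h0.pow 2)).congr fun x => ?_).trans (le_of_eq ?_)
  · rw [(hasDerivAt_orderParam m x).deriv]
    ring
  · congr 1
    push_cast
    ring

theorem momentRatio_lt_two (m k : ℕ) (x : ℝ) : momentRatio m k x < 2 := by
  rw [momentRatio, div_lt_iff₀ (moment_pos _ _ _), ← sub_pos, moment, moment,
    ← intervalIntegral.integral_const_mul,
    ← intervalIntegral.integral_sub (Continuous.intervalIntegrable (by fun_prop) _ _)
      (intervalIntegrable_moment _ _ _ _ _)]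
  refine intervalIntegral.intervalIntegral_pos_of_pos_on
    (Continuous.intervalIntegrable (by fun_prop) _ _) (fun θ hθ => ?_) Real.pi_pos
  have h1 := one_sub_cos_pos hθ
  have h2 := Real.sin_pos_of_mem_Ioo hθ
  have h3 : 0 < 1 + Real.cos θ := by
    have := Real.sin_sq_add_cos_sq θ
    nlinarith [pow_pos h2 2]
  have : 0 < (1 + Real.cos θ) *
      ((1 - Real.cos θ) ^ k * Real.sin θ ^ m * Real.exp (x * Real.cos θ)) := by positivity
  refine this.trans_eq ?_
  ring

/-- The recurrence at `k = 0` rearranges to `(m + 1) c = x R_0 (2 - R_1)`, and `R_1 < 2`. -/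
theorem orderParam_pos (m : ℕ) {x : ℝ} (hx : 0 < x) : 0 < orderParam (m + 2) x := by
  have h := momentRatio_recurrence m 0 x
  have h0 := momentRatio_pos m 0 x
  have h1 := momentRatio_lt_two m (0 + 1) x
  have h2 : 0 < x * momentRatio m 0 x * (2 - momentRatio m (0 + 1) x) :=
    mul_pos (mul_pos hx h0) (by linarith)
  have h3 : 0 < (m + 1 : ℝ) * (1 - momentRatio m 0 x) := by
    push_cast at h
    linarith
  rw [orderParam_eq]
  exact pos_of_mul_pos_right h3 (by positivity)

/-! ### The maximum principle for the elliptic operator -/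

/-- A negative second derivative would make the point a local maximum as well, so `v` would be
locally constant and its second derivative zero. -/
theorem nonneg_of_isLocalMin_of_hasDerivAt {v v₁ : ℝ → ℝ} {v₂ x : ℝ} (hmin : IsLocalMin v x)
    (hv : ∀ᶠ y in 𝓝 x, HasDerivAt v (v₁ y) y) (hv₁ : HasDerivAt v₁ v₂ x) : 0 ≤ v₂ := by
  by_contra! hneg
  have hd : deriv v =ᶠ[𝓝 x] v₁ := hv.mono fun y hy => hy.deriv
  have hdd : deriv (deriv v) x = v₂ := by rw [hd.deriv_eq, hv₁.deriv]
  have hmax : IsLocalMax v x := isLocalMax_of_deriv_deriv_neg (by rwa [hdd]) hmin.deriv_eq_zero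
    hv.self_of_nhds.continuousAt
  have hconst : v =ᶠ[𝓝 x] fun _ => v x := by
    filter_upwards [hmin, hmax] with y h1 h2 using le_antisymm h2 h1
  have h0 : deriv v =ᶠ[𝓝 x] fun _ => (0 : ℝ) := by
    have := hconst.deriv
    simpa using this
  have : deriv (deriv v) x = 0 := by rw [h0.deriv_eq, deriv_const]
  linarith

/-- The value at `θ` of the operator `ellipticOp (m + 2) κ` on a function whose value and first two
derivatives at `θ` are `a`, `b`, `c`. -/
noncomputable def ellipticVal (m : ℕ) (κ θ a b c : ℝ) : ℝ :=
  -(c + (m * Real.cos θ / Real.sin θ - κ * Real.sin θ) * b) + m / Real.sin θ ^ 2 * a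

/-- Makes `θ / (κ + 2m/3)` a supersolution. The operator sends `θ` to `κ sin θ + m (θ - sin θ cos θ)
/ sin² θ`, and `θ - sin θ cos θ ≥ (2/3) sin³ θ`, with equality to leading order at `0`. -/
theorem mul_sin_le_ellipticVal_id (m : ℕ) (κ : ℝ) {θ : ℝ} (hθ : θ ∈ Set.Ioo 0 Real.pi) :
    (κ + 2 * m / 3) * Real.sin θ ≤ ellipticVal m κ θ θ 1 0 := by
  have hs := Real.sin_pos_of_mem_Ioo hθ
  have key : 2 / 3 * Real.sin θ ^ 3 ≤ θ - Real.sin θ * Real.cos θ := by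
    have hmono : MonotoneOn (fun t => t - Real.sin t * Real.cos t - 2 / 3 * Real.sin t ^ 3)
        (Set.Ici 0) := by
      refine monotoneOn_of_deriv_nonneg (convex_Ici 0) (by fun_prop) (by fun_prop) fun t _ => ?_
      have hd : HasDerivAt (fun t => t - Real.sin t * Real.cos t - 2 / 3 * Real.sin t ^ 3)
          (2 * Real.sin t ^ 2 * (1 - Real.cos t)) t := by
        refine (((hasDerivAt_id t).sub ((Real.hasDerivAt_sin t).mul (Real.hasDerivAt_cos t))).sub
          (((Real.hasDerivAt_sin t).pow 3).const_mul (2 / 3))).congr_deriv ?_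
        simp only [Nat.cast_ofNat, Nat.reduceSub]
        linear_combination - Real.sin_sq_add_cos_sq t
      rw [hd.deriv]
      have := Real.cos_le_one t
      have : 0 ≤ 1 - Real.cos t := by linarith
      positivity
    have := hmono Set.self_mem_Ici hθ.1.le hθ.1.le
    simp only [Real.sin_zero] at this
    linarith
  have heq : ellipticVal m κ θ θ 1 0 - (κ + 2 * m / 3) * Real.sin θ =
      m / Real.sin θ ^ 2 * (θ - Real.sin θ * Real.cos θ - 2 / 3 * Real.sin θ ^ 3) := by
    rw [ellipticVal]
    field_simp
    ring
  have : 0 ≤ m / Real.sin θ ^ 2 * (θ - Real.sin θ * Real.cos θ - 2 / 3 * Real.sin θ ^ 3) :=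
    mul_nonneg (by positivity) (by linarith)
  linarith

/-- For `A > 0` the left side is positive only when `x² > B / A`, and there `x^(r-1)` is bounded. -/
theorem exists_rpow_mul_sub_le {A B r : ℝ} (hB : 0 < B) (hr : r ≤ 0) :
    ∃ C, 0 ≤ C ∧ ∀ x, 0 < x → x ^ r * (A - B / x ^ 2) ≤ C * x := by
  rcases le_or_gt A 0 with hA | hA
  · refine ⟨0, le_rfl, fun x hx => ?_⟩
    rw [zero_mul]
    refine mul_nonpos_of_nonneg_of_nonpos (by positivity) ?_
    have : 0 ≤ B / x ^ 2 := by positivity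
    linarith
  · set δ := √(B / A) with hδ
    have hδ0 : 0 < δ := Real.sqrt_pos.mpr (by positivity)
    refine ⟨A * δ ^ (r - 1), by positivity, fun x hx => ?_⟩
    rcases le_or_gt A (B / x ^ 2) with h | h
    · have h1 : x ^ r * (A - B / x ^ 2) ≤ 0 :=
        mul_nonpos_of_nonneg_of_nonpos (by positivity) (by linarith)
      have h2 : 0 ≤ A * δ ^ (r - 1) * x := by positivity
      linarith
    · have hx2 : δ ≤ x := by
        rw [hδ, Real.sqrt_le_left hx.le, div_le_iff₀ hA]
        rw [div_lt_iff₀ (by positivity)] at h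
        linarith
      have h1 : x ^ (r - 1) ≤ δ ^ (r - 1) := Real.rpow_le_rpow_of_nonpos hδ0 hx2 (by linarith)
      have h2 : x ^ r = x ^ (r - 1) * x := by rw [Real.rpow_sub_one hx.ne']; field_simp
      calc x ^ r * (A - B / x ^ 2) ≤ x ^ r * A := by
            gcongr
            have : 0 ≤ B / x ^ 2 := by positivity
            linarith
        _ = A * x ^ (r - 1) * x := by rw [h2]; ring
        _ ≤ A * δ ^ (r - 1) * x := by gcongr

/-- A strict supersolution which blows up like `sin⁻ᵐᐟ²` at the end points. -/
theorem exists_barrier (m : ℕ) {κ : ℝ} (hκ : 0 < κ) : ∃ φ φ₁ φ₂ : ℝ → ℝ,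
    (∀ θ ∈ Set.Ioo 0 Real.pi, HasDerivAt φ (φ₁ θ) θ) ∧
    (∀ θ ∈ Set.Ioo 0 Real.pi, HasDerivAt φ₁ (φ₂ θ) θ) ∧
    (∀ θ ∈ Set.Ioo 0 Real.pi, 0 < ellipticVal m κ θ (φ θ) (φ₁ θ) (φ₂ θ)) ∧
    ∀ θ ∈ Set.Ioo 0 Real.pi, 1 ≤ Real.sin θ ^ ((m : ℝ) / 2) * φ θ := by
  -- The exponent `-m/2` is the midpoint weight of `V`; when `m > 0` it lies strictly between the
  -- characteristic exponents `-m` and `1` at the poles, so `sin^r` is a strict supersolution near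
  -- them, with leading coefficient `B > 0`.
  set r : ℝ := -((m : ℝ) / 2) with hr
  set B : ℝ := (m : ℝ) ^ 2 / 4 + m / 2 with hB
  set A : ℝ := (m : ℝ) ^ 2 / 4 + κ * m / 2 with hA
  obtain ⟨C, hC, hCx⟩ : ∃ C, 0 ≤ C ∧ ∀ x : ℝ, 0 < x → x ^ r * (A - B / x ^ 2) ≤ C * x := by
    rcases Nat.eq_zero_or_pos m with h | h
    · refine ⟨0, le_rfl, fun x hx => ?_⟩
      simp [hA, hB, h]
    · have : (0 : ℝ) < m := by exact_mod_cast h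
      exact exists_rpow_mul_sub_le (by positivity) (by rw [hr]; linarith)
  -- Away from the poles `sin^r` may fail to be a supersolution by at most `C sin θ`; the term `D θ`
  -- contributes at least `D κ sin θ = (C + 1) sin θ`.
  set D : ℝ := (C + 1) / κ with hD
  have hD0 : 0 < D := by positivity
  refine ⟨fun θ => Real.sin θ ^ r + D * θ,
    fun θ => r * Real.sin θ ^ r * Real.cos θ / Real.sin θ + D,
    fun θ => r * (r - 1) * Real.sin θ ^ r * Real.cos θ ^ 2 / Real.sin θ ^ 2 - r * Real.sin θ ^ r,
    ?_, ?_, ?_, ?_⟩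
  · intro θ hθ
    have hs := Real.sin_pos_of_mem_Ioo hθ
    refine (((Real.hasDerivAt_sin θ).rpow_const (p := r) (Or.inl hs.ne')).add
      ((hasDerivAt_id θ).const_mul D)).congr_deriv ?_
    rw [Real.rpow_sub_one hs.ne']
    ring
  · intro θ hθ
    have hs := Real.sin_pos_of_mem_Ioo hθ
    refine (((((Real.hasDerivAt_sin θ).rpow_const (p := r) (Or.inl hs.ne')).const_mul r).mul
      (Real.hasDerivAt_cos θ)).div (Real.hasDerivAt_sin θ) hs.ne' |>.add_const D).congr_deriv ?_
    simp only [Pi.mul_apply]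
    rw [Real.rpow_sub_one hs.ne']
    field_simp
    ring
  · intro θ hθ
    have hs := Real.sin_pos_of_mem_Ioo hθ
    have h1 := mul_sin_le_ellipticVal_id m κ hθ
    have h2 := hCx _ hs
    have hS : 0 < Real.sin θ ^ r := by positivity
    have hm : 0 ≤ κ * m / 2 * Real.sin θ ^ r * (1 - Real.cos θ) :=
      mul_nonneg (by positivity) (by linarith [Real.cos_le_one θ])
    have heq : ellipticVal m κ θ (Real.sin θ ^ r + D * θ)
        (r * Real.sin θ ^ r * Real.cos θ / Real.sin θ + D)
        (r * (r - 1) * Real.sin θ ^ r * Real.cos θ ^ 2 / Real.sin θ ^ 2 - r * Real.sin θ ^ r) =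
        -(Real.sin θ ^ r * (A - B / Real.sin θ ^ 2)) +
          κ * m / 2 * Real.sin θ ^ r * (1 - Real.cos θ) + D * ellipticVal m κ θ θ 1 0 := by
      rw [ellipticVal, ellipticVal, Real.cos_sq', hr, hA, hB]
      have hc2 := Real.cos_sq' θ
      field_simp
      ring_nf
      rw [hc2]
      ring
    rw [heq]
    have h3 : D * ((κ + 2 * m / 3) * Real.sin θ) ≤ D * ellipticVal m κ θ θ 1 0 := by gcongr
    have h4 : D * ((κ + 2 * m / 3) * Real.sin θ) =
        (C + 1) * Real.sin θ + D * (2 * m / 3) * Real.sin θ := by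
      rw [hD]
      field_simp
    have h5 : 0 ≤ D * (2 * m / 3) * Real.sin θ := by positivity
    linarith
  · intro θ hθ
    have hs := Real.sin_pos_of_mem_Ioo hθ
    have h1 : Real.sin θ ^ ((m : ℝ) / 2) * Real.sin θ ^ r = 1 := by
      rw [← Real.rpow_add hs, hr, add_neg_cancel, Real.rpow_zero]
    have h2 : 0 ≤ Real.sin θ ^ ((m : ℝ) / 2) * (D * θ) := by
      have := hθ.1
      positivity
    rw [mul_add, h1]
    linarith

/-- Membership in `V` controls only `sin^(m/2) u` at the end points, so `ε φ` is added, with `φ` the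
barrier blowing up at that rate. Then `u + ε φ` is positive near both ends, and a negative interior
minimum would contradict the strict inequality for `φ`. The strictness matters for `m = 0`, where
there is no zero-order term. -/
theorem nonneg_of_ellipticVal_nonneg (m : ℕ) {κ : ℝ} (hκ : 0 < κ) {u u₁ u₂ : ℝ → ℝ}
    (hu : ∀ θ ∈ Set.Ioo 0 Real.pi, HasDerivAt u (u₁ θ) θ)
    (hu₁ : ∀ θ ∈ Set.Ioo 0 Real.pi, HasDerivAt u₁ (u₂ θ) θ)
    (hL : ∀ θ ∈ Set.Ioo 0 Real.pi, 0 ≤ ellipticVal m κ θ (u θ) (u₁ θ) (u₂ θ))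
    (h0 : ∀ ε > 0, ∀ᶠ θ in 𝓝[>] 0, -ε < Real.sin θ ^ ((m : ℝ) / 2) * u θ)
    (hpi : ∀ ε > 0, ∀ᶠ θ in 𝓝[<] Real.pi, -ε < Real.sin θ ^ ((m : ℝ) / 2) * u θ) :
    ∀ θ ∈ Set.Ioo 0 Real.pi, 0 ≤ u θ := by
  obtain ⟨φ, φ₁, φ₂, hφ, hφ₁, hφL, hφb⟩ := exists_barrier m hκ
  have main : ∀ ε > 0, ∀ θ ∈ Set.Ioo 0 Real.pi, 0 ≤ u θ + ε * φ θ := by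
    intro ε hε θ₀ hθ₀
    by_contra! hneg
    have hpos : ∀ θ ∈ Set.Ioo 0 Real.pi, -ε < Real.sin θ ^ ((m : ℝ) / 2) * u θ →
        0 < u θ + ε * φ θ := by
      intro θ hθ h
      have hs := Real.sin_pos_of_mem_Ioo hθ
      have hS : 0 < Real.sin θ ^ ((m : ℝ) / 2) := by positivity
      have h1 := mul_le_mul_of_nonneg_left (hφb θ hθ) hε.le
      refine pos_of_mul_pos_right (b := u θ + ε * φ θ) (a := Real.sin θ ^ ((m : ℝ) / 2)) ?_ hS.le
      linarith
    obtain ⟨a, ha, hau⟩ := mem_nhdsGT_iff_exists_Ioo_subset.mp (h0 ε hε)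
    obtain ⟨b, hb, hbu⟩ := mem_nhdsLT_iff_exists_Ioo_subset.mp (hpi ε hε)
    have ha : 0 < a := ha
    have hb : b < Real.pi := hb
    -- The compact interval contains `θ₀`, and its end points lie where `u + ε φ` is positive, so
    -- the minimum is interior.
    set a' := min a θ₀ / 2 with ha'
    set b' := (max b θ₀ + Real.pi) / 2 with hb'
    have h1 : 0 < min a θ₀ := lt_min ha hθ₀.1
    have h2 : max b θ₀ < Real.pi := max_lt hb hθ₀.2
    have h1a := min_le_left a θ₀
    have h1b := min_le_right a θ₀
    have h2a := le_max_left b θ₀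
    have h2b := le_max_right b θ₀
    have hsub : Set.Icc a' b' ⊆ Set.Ioo 0 Real.pi := fun θ hθ =>
      ⟨by linarith [hθ.1], by linarith [hθ.2]⟩
    obtain ⟨x, hx, hxmin⟩ := isCompact_Icc.exists_isMinOn (s := Set.Icc a' b')
      (f := fun θ => u θ + ε * φ θ) ⟨θ₀, by linarith, by linarith⟩ fun θ hθ =>
        ((hu θ (hsub hθ)).add ((hφ θ (hsub hθ)).const_mul ε)).continuousAt.continuousWithinAt
    have hxneg : u x + ε * φ x < 0 :=
      (hxmin (show θ₀ ∈ Set.Icc a' b' from ⟨by linarith, by linarith⟩)).trans_lt hneg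
    have hxa : a' < x := by
      refine lt_of_le_of_ne hx.1 fun h => ?_
      have := hpos x (hsub hx) (hau ⟨(hsub hx).1, by rw [← h]; linarith⟩)
      linarith
    have hxb : x < b' := by
      refine lt_of_le_of_ne hx.2 fun h => ?_
      have := hpos x (hsub hx) (hbu ⟨by rw [h]; linarith, (hsub hx).2⟩)
      linarith
    have hlm : IsLocalMin (fun θ => u θ + ε * φ θ) x :=
      hxmin.isLocalMin (Icc_mem_nhds hxa hxb)
    have hd : ∀ θ ∈ Set.Ioo 0 Real.pi,
        HasDerivAt (fun θ => u θ + ε * φ θ) (u₁ θ + ε * φ₁ θ) θ := fun θ hθ =>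
      (hu θ hθ).add ((hφ θ hθ).const_mul ε)
    have hxI := hsub hx
    have h2nd := nonneg_of_isLocalMin_of_hasDerivAt hlm
      (by filter_upwards [Ioo_mem_nhds hxI.1 hxI.2] with θ hθ using hd θ hθ)
      ((hu₁ x hxI).add ((hφ₁ x hxI).const_mul ε))
    have h1st : u₁ x + ε * φ₁ x = 0 := by
      rw [← (hd x hxI).deriv]
      exact hlm.deriv_eq_zero
    have hs := Real.sin_pos_of_mem_Ioo hxI
    have hLx := hL x hxI
    have hφx := mul_pos hε (hφL x hxI)
    have heq : ellipticVal m κ x (u x) (u₁ x) (u₂ x) +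
        ε * ellipticVal m κ x (φ x) (φ₁ x) (φ₂ x) =
        -(u₂ x + ε * φ₂ x) -
          (m * Real.cos x / Real.sin x - κ * Real.sin x) * (u₁ x + ε * φ₁ x) +
          m / Real.sin x ^ 2 * (u x + ε * φ x) := by
      simp only [ellipticVal]
      ring
    have h3 : m / Real.sin x ^ 2 * (u x + ε * φ x) ≤ 0 :=
      mul_nonpos_of_nonneg_of_nonpos (by positivity) hxneg.le
    rw [h1st, mul_zero] at heq
    linarith
  intro θ hθ
  have hlim : Tendsto (fun ε : ℝ => u θ + ε * φ θ) (𝓝[>] 0) (𝓝 (u θ + 0 * φ θ)) :=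
    (tendsto_const_nhds.add (tendsto_id.mul_const _)).mono_left nhdsWithin_le_nhds
  rw [zero_mul, add_zero] at hlim
  exact ge_of_tendsto hlim (by
    filter_upwards [self_mem_nhdsWithin] with ε hε using main ε hε θ hθ)

/-! ### Power series solutions of the elliptic equation near a pole -/

theorem exists_bound_deriv_coeff {a : ℕ → ℝ} {q q' C : ℝ} (hq : 0 < q) (hqq' : q < q')
    (ha : ∀ k, |a k| ≤ C * q ^ k) : ∃ C', ∀ k : ℕ, |(k + 1) * a (k + 1)| ≤ C' * q' ^ k := by
  have hq' : 0 < q' := hq.trans hqq'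
  have hC : 0 ≤ C := by simpa using (abs_nonneg _).trans (ha 0)
  have hlim := tendsto_self_mul_const_pow_of_lt_one (r := q / q') (by positivity)
    ((div_lt_one hq').mpr hqq')
  obtain ⟨M, hM⟩ := hlim.bddAbove_range
  have hM' : ∀ k : ℕ, k * (q / q') ^ k ≤ M := fun k => hM ⟨k, rfl⟩
  refine ⟨C * M * q', fun k => ?_⟩
  have h1 := hM' (k + 1)
  rw [abs_mul, abs_of_nonneg (by positivity : (0 : ℝ) ≤ k + 1)]
  calc (k + 1) * |a (k + 1)| ≤ (k + 1) * (C * q ^ (k + 1)) := by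
        gcongr
        exact ha _
    _ = C * (((k + 1 : ℕ) : ℝ) * (q / q') ^ (k + 1)) * q' ^ (k + 1) := by
        rw [div_pow]
        push_cast
        field_simp
    _ ≤ C * M * q' ^ (k + 1) := by gcongr
    _ = C * M * q' * q' ^ k := by ring

theorem summable_of_bound {a : ℕ → ℝ} {q C x : ℝ} (hq : 0 < q)
    (ha : ∀ k, |a k| ≤ C * q ^ k) (hx : |x| * q < 1) : Summable fun k => a k * x ^ k := by
  refine Summable.of_norm_bounded (g := fun k => C * (|x| * q) ^ k)
    ((summable_geometric_of_lt_one (by positivity) hx).mul_left C) fun k => ?_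
  rw [Real.norm_eq_abs, abs_mul, abs_pow, mul_pow]
  calc |a k| * |x| ^ k ≤ C * q ^ k * |x| ^ k := by
        gcongr
        exact ha k
    _ = _ := by ring

theorem hasDerivAt_tsum_pow {a : ℕ → ℝ} {q C x : ℝ} (hq : 0 < q)
    (ha : ∀ k, |a k| ≤ C * q ^ k) (hx : |x| * q < 1) :
    HasDerivAt (fun y => ∑' k, a k * y ^ k) (∑' k : ℕ, (k + 1) * a (k + 1) * x ^ k) x := by
  obtain ⟨r, hxr, hr⟩ : ∃ r, |x| < r ∧ r * q < 1 := by
    obtain ⟨r, h1, h2⟩ := exists_between ((lt_div_iff₀ hq).mpr hx)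
    exact ⟨r, h1, (lt_div_iff₀ hq).mp h2⟩
  have hr0 : 0 < r := (abs_nonneg x).trans_lt hxr
  obtain ⟨q', hqq', hq'⟩ : ∃ q', q < q' ∧ r * q' < 1 := by
    obtain ⟨s, h1, h2⟩ := exists_between ((lt_div_iff₀' hr0).mpr hr)
    exact ⟨s, h1, (lt_div_iff₀' hr0).mp h2⟩
  obtain ⟨C', hC'⟩ := exists_bound_deriv_coeff hq hqq' ha
  have hq'0 := hq.trans hqq'
  have hsum : Summable fun k : ℕ => |a k| * (k * r ^ (k - 1)) := by
    rw [← summable_nat_add_iff 1]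
    refine Summable.of_nonneg_of_le (fun k => by positivity) (fun k => ?_)
      ((summable_geometric_of_lt_one (r := r * q') (by positivity) hq').mul_left C')
    have := hC' k
    rw [abs_mul, abs_of_nonneg (by positivity : (0 : ℝ) ≤ k + 1)] at this
    rw [Nat.add_sub_cancel, mul_pow]
    push_cast
    calc |a (k + 1)| * ((k + 1) * r ^ k) = (k + 1) * |a (k + 1)| * r ^ k := by ring
      _ ≤ C' * q' ^ k * r ^ k := by gcongr
      _ = _ := by ring
  have h := hasDerivAt_tsum_of_isPreconnected (y₀ := 0) (y := x) (t := Metric.ball (0 : ℝ) r)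
    (g := fun k y => a k * y ^ k) (g' := fun k y => a k * (k * y ^ (k - 1))) hsum
    Metric.isOpen_ball (convex_ball 0 r).isPreconnected
    (fun k y _ => (hasDerivAt_pow k y).const_mul (a k)) (fun k y hy => ?_)
    (Metric.mem_ball_self hr0) (summable_of_bound hq ha (by simp)) (by simpa using hxr)
  · refine h.congr_deriv ?_
    have hs : Summable fun k : ℕ => a k * (k * x ^ (k - 1)) := by
      refine Summable.of_norm_bounded hsum fun k => ?_
      rw [Real.norm_eq_abs, abs_mul, abs_mul, abs_pow, Nat.abs_cast]
      gcongr
    rw [hs.tsum_eq_zero_add]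
    simp only [CharP.cast_eq_zero, zero_mul, mul_zero, zero_add, Nat.add_sub_cancel]
    congr 1 with k
    push_cast
    ring
  · have hy' : |y| ≤ r := by
      rw [mem_ball_zero_iff, Real.norm_eq_abs] at hy
      exact hy.le
    rw [Real.norm_eq_abs, abs_mul, abs_mul, abs_pow, Nat.abs_cast]
    gcongr

/-- The coefficients of the power series solution, in powers of `1 - μ`. -/
noncomputable def frobeniusCoeff (m : ℕ) (κ f a₀ : ℝ) : ℕ → ℝ
  | 0 => a₀
  | 1 => ((m + 1 + κ) * a₀ - f) / (m + 3)
  | k + 2 => (((2 * k + 3) * κ + (k + 2) * (k + m + 2)) * frobeniusCoeff m κ f a₀ (k + 1) -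
      κ * (k + 1) * frobeniusCoeff m κ f a₀ k) / ((k + 2) * (2 * k + m + 5))

/-- The condition on `p` and `q` is what strong induction needs for the rate `3/4`; `C` is chosen to
cover the first `K + 2` terms. -/
theorem exists_geometric_bound {a p q : ℕ → ℝ} {K : ℕ} (hp : ∀ k, 0 ≤ p k) (hq : ∀ k, 0 ≤ q k)
    (hpq : ∀ k, K ≤ k → p k + 4 / 3 * q k ≤ 3 / 4)
    (ha : ∀ k, |a (k + 2)| ≤ p k * |a (k + 1)| + q k * |a k|) :
    ∃ C, ∀ k, |a k| ≤ C * (3 / 4) ^ k := by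
  set C := ∑ i ∈ Finset.range (K + 2), |a i| * (4 / 3) ^ i with hC
  have hC0 : 0 ≤ C := Finset.sum_nonneg fun i _ => by positivity
  refine ⟨C, fun k => ?_⟩
  induction k using Nat.strong_induction_on with
  | _ k ih =>
    rcases lt_or_ge k (K + 2) with hk | hk
    · have h1 : |a k| * (4 / 3) ^ k ≤ C :=
        Finset.single_le_sum (f := fun i => |a i| * (4 / 3 : ℝ) ^ i)
          (fun i _ => by positivity) (Finset.mem_range.mpr hk)
      calc |a k| = |a k| * (4 / 3) ^ k * (3 / 4) ^ k := by
            rw [mul_assoc, ← mul_pow]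
            norm_num
        _ ≤ C * (3 / 4) ^ k := by gcongr
    · obtain ⟨j, rfl⟩ : ∃ j, k = j + 2 := ⟨k - 2, by omega⟩
      have h1 := ih (j + 1) (by omega)
      have h2 := ih j (by omega)
      calc |a (j + 2)| ≤ p j * |a (j + 1)| + q j * |a j| := ha j
        _ ≤ p j * (C * (3 / 4) ^ (j + 1)) + q j * (C * (3 / 4) ^ j) := by
            gcongr
            · exact hp j
            · exact hq j
        _ = C * (3 / 4) ^ (j + 1) * (p j + 4 / 3 * q j) := by ring
        _ ≤ C * (3 / 4) ^ (j + 1) * (3 / 4) := by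
            gcongr
            exact hpq j (by omega)
        _ = C * (3 / 4) ^ (j + 2) := by ring

theorem exists_frobeniusCoeff_bound (m : ℕ) (κ f a₀ : ℝ) :
    ∃ C, ∀ k, |frobeniusCoeff m κ f a₀ k| ≤ C * (3 / 4) ^ k := by
  -- The recursion weights tend to `1/2` and `0`, because the other singular point is at `s = 2`;
  -- beyond this `K` their error is at most `1/4`.
  obtain ⟨K, hK⟩ := exists_nat_ge (4 * (m + 3 * |κ|))
  refine exists_geometric_bound (K := K)
    (p := fun k => 1 / 2 + (m + |κ|) / (k + 2)) (q := fun k => |κ| / (k + 2))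
    (fun k => by positivity) (fun k => by positivity) (fun k hk => ?_) fun k => ?_
  · have h1 : (K : ℝ) ≤ k := by exact_mod_cast hk
    have h2 : (m + 3 * |κ|) / ((k : ℝ) + 2) ≤ 1 / 4 := by
      rw [div_le_iff₀ (by positivity)]
      linarith
    have h3 : 1 / 2 + (m + |κ|) / ((k : ℝ) + 2) + 4 / 3 * (|κ| / (k + 2)) =
        1 / 2 + (m + 3 * |κ|) / ((k : ℝ) + 2) - 2 / 3 * (|κ| / (k + 2)) := by
      field_simp
      ring
    have h4 : 0 ≤ 2 / 3 * (|κ| / ((k : ℝ) + 2)) := by positivity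
    linarith
  · have hA : |((2 * k + 3) * κ + (k + 2) * (k + m + 2)) / ((k + 2) * (2 * k + m + 5))| ≤
        1 / 2 + (m + |κ|) / ((k : ℝ) + 2) := by
      have h1 : |((2 * k + 3) * κ + (k + 2) * (k + m + 2) : ℝ)| ≤
          (2 * k + 3) * |κ| + (k + 2) * (k + m + 2) := by
        refine (abs_add_le _ _).trans (le_of_eq ?_)
        rw [abs_mul, abs_of_nonneg (by positivity : (0 : ℝ) ≤ 2 * k + 3),
          abs_of_nonneg (by positivity : (0 : ℝ) ≤ (k + 2) * (k + m + 2))]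
      rw [abs_div, abs_of_nonneg (by positivity : (0 : ℝ) ≤ (k + 2) * (2 * k + m + 5)),
        div_le_iff₀ (by positivity)]
      refine h1.trans ?_
      have h2 : (1 / 2 + (m + |κ|) / ((k : ℝ) + 2)) * ((k + 2) * (2 * k + m + 5)) =
          ((k + 2) / 2 + (m + |κ|)) * (2 * k + m + 5) := by
        field_simp
      rw [h2]
      have h3 : 0 ≤ |κ| * (m + 2) := by positivity
      have h4 : (0 : ℝ) ≤ m * k := by positivity
      have h5 : (0 : ℝ) ≤ m * m := by positivity
      have h6 : (0 : ℝ) ≤ m := by positivity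
      have h7 : (0 : ℝ) ≤ k := by positivity
      nlinarith
    have hB : |κ * (k + 1) / ((k + 2) * (2 * k + m + 5))| ≤ |κ| / ((k : ℝ) + 2) := by
      rw [abs_div, abs_mul, abs_of_nonneg (by positivity : (0 : ℝ) ≤ (k + 2) * (2 * k + m + 5)),
        abs_of_nonneg (by positivity : (0 : ℝ) ≤ k + 1), ← div_div, div_right_comm]
      refine div_le_of_le_mul₀ (by positivity) (by positivity) ?_
      rw [div_mul_cancel₀ _ (by positivity), div_le_iff₀ (by positivity)]
      refine mul_le_mul_of_nonneg_left ?_ (abs_nonneg κ)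
      linarith [(Nat.cast_nonneg m : (0 : ℝ) ≤ m), (Nat.cast_nonneg k : (0 : ℝ) ≤ k)]
    rw [frobeniusCoeff, sub_div, mul_div_right_comm, mul_div_right_comm _ (frobeniusCoeff _ _ _ _ k)]
    refine (abs_sub _ _).trans ?_
    rw [abs_mul, abs_mul]
    gcongr

theorem hasSum_shift {c b : ℕ → ℝ} {x S : ℝ} (h : HasSum (fun k => c k * x ^ k) S)
    (h0 : b 0 = 0) (hb : ∀ k, b (k + 1) = c k) : HasSum (fun k => b k * x ^ k) (x * S) := by
  rw [← hasSum_nat_add_iff' 1]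
  simp only [hb, Finset.range_one, Finset.sum_singleton, h0, zero_mul, sub_zero]
  refine (h.mul_left x).congr_fun ?_
  intro k
  ring

/-- The differential operator for `h`, where `g θ = sin θ * h (cos θ)`, applied to a function whose
value and first two derivatives at `μ` are `a`, `b`, `c`. -/
def hVal (m : ℕ) (κ μ a b c : ℝ) : ℝ :=
  -((1 - μ ^ 2) * c) - (κ * (1 - μ ^ 2) - (m + 3) * μ) * b + (m + 1 + κ * μ) * a

/-- `Y` is a solution in the variable `s = 1 - μ`, regular near `s = 0`. -/
structure IsLocalSol (m : ℕ) (κ f : ℝ) (Y Y₁ Y₂ : ℝ → ℝ) : Prop where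
  deriv : ∀ s, |s| < 5 / 4 → HasDerivAt Y (Y₁ s) s
  deriv₁ : ∀ s, |s| < 5 / 4 → HasDerivAt Y₁ (Y₂ s) s
  eq : ∀ s, |s| < 5 / 4 → hVal m κ (1 - s) (Y s) (-Y₁ s) (Y₂ s) = f

theorem exists_isLocalSol (m : ℕ) (κ f a₀ : ℝ) :
    ∃ Y Y₁ Y₂, IsLocalSol m κ f Y Y₁ Y₂ ∧ Y 0 = a₀ := by
  obtain ⟨a, C, ha0, ha1, harec, hC⟩ : ∃ (a : ℕ → ℝ) (C : ℝ), a 0 = a₀ ∧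
      (m + 3) * a 1 = (m + 1 + κ) * a₀ - f ∧
      (∀ k : ℕ, (k + 2) * (2 * k + m + 5) * a (k + 2) = ((2 * k + 3) * κ +
        (k + 2) * (k + m + 2)) * a (k + 1) - κ * (k + 1) * a k) ∧
      ∀ k, |a k| ≤ C * (3 / 4) ^ k := by
    obtain ⟨C, hC⟩ := exists_frobeniusCoeff_bound m κ f a₀
    refine ⟨frobeniusCoeff m κ f a₀, C, rfl, ?_, fun k => ?_, hC⟩
    · rw [frobeniusCoeff]
      field_simp
    · rw [frobeniusCoeff]
      field_simp
  -- The rates `3/4 < 77/100 < 78/100`, for the series and its two derivatives, all stay below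
  -- `4/5`, giving convergence for `|s| < 5/4`, hence past the equator `s = 1`.
  obtain ⟨C₁, hC₁⟩ := exists_bound_deriv_coeff (q := 3 / 4) (q' := 77 / 100) (by norm_num)
    (by norm_num) hC
  obtain ⟨C₂, hC₂⟩ := exists_bound_deriv_coeff (q := 77 / 100) (q' := 78 / 100) (by norm_num)
    (by norm_num) hC₁
  refine ⟨fun s => ∑' k, a k * s ^ k, fun s => ∑' k : ℕ, (k + 1) * a (k + 1) * s ^ k,
    fun s => ∑' k : ℕ, (k + 1) * (((k + 1 : ℕ) + 1) * a (k + 1 + 1)) * s ^ k,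
    ⟨fun s hs => hasDerivAt_tsum_pow (q := 3 / 4) (by norm_num) hC (by linarith),
      fun s hs => hasDerivAt_tsum_pow (q := 77 / 100) (by norm_num) hC₁ (by linarith),
      fun s hs => ?_⟩, ?_⟩
  · have h := (summable_of_bound (q := 3 / 4) (x := s) (by norm_num) hC (by linarith)).hasSum
    have h₁ := (summable_of_bound (q := 77 / 100) (x := s) (by norm_num) hC₁ (by linarith)).hasSum
    have h₂ := (summable_of_bound (q := 78 / 100) (x := s) (by norm_num) hC₂ (by linarith)).hasSum
    -- Each factor `s` in the equation shifts coefficients by one; expanding `1 - μ² = 2 s - s²`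
    -- needs exactly these shifted series.
    have hs0 := hasSum_shift (b := fun k => Nat.casesOn k 0 a) h rfl fun k => rfl
    have hs1 := hasSum_shift (b := fun k => k * a k) h₁ (by simp) fun k => by push_cast; ring
    have hss1 := hasSum_shift (b := fun k => Nat.casesOn k 0 fun k => k * a k) hs1 rfl
      fun k => rfl
    have hs2 := hasSum_shift (b := fun k => k * ((k + 1) * a (k + 1))) h₂ (by simp)
      fun k => by push_cast; ring
    have hss2 := hasSum_shift (b := fun k => k * (k - 1) * a k) hs2 (by simp)
      fun k => by push_cast; ring
    have htot := ((((((((hs2.mul_left (-2)).add hss2).add (hs1.mul_left (2 * κ))).sub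
      (hss1.mul_left κ)).sub (h₁.mul_left (m + 3 : ℝ))).add (hs1.mul_left (m + 3 : ℝ))).add
      (h.mul_left (m + 1 + κ))).sub (hs0.mul_left κ))
    have hf := hasSum_single (f := fun k : ℕ => if k = 0 then f else 0) 0
      (fun k hk => if_neg hk)
    rw [if_pos rfl] at hf
    refine Eq.trans ?_ (htot.unique (hf.congr_fun fun k => ?_))
    · simp only [hVal]
      ring
    · rcases k with _ | k
      · simp only [CharP.cast_eq_zero, if_pos, pow_zero, ha0, Nat.rec_zero]
        linear_combination -ha1
      · rw [if_neg (Nat.succ_ne_zero k)]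
        push_cast
        linear_combination -(s ^ (k + 1)) * harec k
  · have : ∀ k, k ≠ 0 → a k * (0 : ℝ) ^ k = 0 := fun k hk => by simp [hk]
    show ∑' k, a k * (0 : ℝ) ^ k = a₀
    rw [tsum_eq_single 0 this]
    simp [ha0]

/-! ### Existence of the generalized collisional invariant -/

theorem IsLocalSol.lincomb {m : ℕ} {κ f f' : ℝ} {Y Y₁ Y₂ Z Z₁ Z₂ : ℝ → ℝ}
    (hY : IsLocalSol m κ f Y Y₁ Y₂) (hZ : IsLocalSol m κ f' Z Z₁ Z₂) (a : ℝ) :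
    IsLocalSol m κ (f + a * f') (fun s => Y s + a * Z s) (fun s => Y₁ s + a * Z₁ s)
      (fun s => Y₂ s + a * Z₂ s) where
  deriv s hs := (hY.deriv s hs).add ((hZ.deriv s hs).const_mul a)
  deriv₁ s hs := (hY.deriv₁ s hs).add ((hZ.deriv₁ s hs).const_mul a)
  eq s hs := by
    have h1 := hY.eq s hs
    have h2 := hZ.eq s hs
    simp only [hVal] at h1 h2 ⊢
    linear_combination h1 + a * h2

theorem hasDerivAt_glue {F F' G G' : ℝ → ℝ} {r : ℝ} (hr : 0 < r)
    (hF : ∀ x, 0 ≤ x → x < r → HasDerivAt F (F' x) x)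
    (hG : ∀ x, -r < x → x ≤ 0 → HasDerivAt G (G' x) x) (h0 : F 0 = G 0) (h1 : F' 0 = G' 0)
    {x : ℝ} (hx : |x| < r) :
    HasDerivAt (fun x => if 0 ≤ x then F x else G x) (if 0 ≤ x then F' x else G' x) x := by
  obtain ⟨hxl, hxr⟩ := abs_lt.mp hx
  rcases lt_trichotomy x 0 with h | h | h
  · rw [if_neg h.not_ge]
    refine (hG x hxl h.le).congr_of_eventuallyEq ?_
    filter_upwards [Iio_mem_nhds h] with y hy using if_neg (not_le.mpr hy)
  · subst h
    rw [if_pos le_rfl]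
    have hR : HasDerivWithinAt (fun x => if 0 ≤ x then F x else G x) (F' 0) (Set.Ici 0) 0 :=
      (hF 0 le_rfl hr).hasDerivWithinAt.congr (fun y hy => if_pos hy) (if_pos le_rfl)
    have hL : HasDerivWithinAt (fun x => if 0 ≤ x then F x else G x) (F' 0) (Set.Iic 0) 0 := by
      rw [h1]
      refine (hG 0 (by linarith) le_rfl).hasDerivWithinAt.congr (fun y hy => ?_)
        ((if_pos le_rfl).trans h0)
      rcases (Set.mem_Iic.mp hy).lt_or_eq with hy | rfl
      · exact if_neg (not_le.mpr hy)
      · exact (if_pos le_rfl).trans h0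
    have := hL.union hR
    rwa [Set.Iic_union_Ici, hasDerivWithinAt_univ] at this
  · rw [if_pos h.le]
    refine (hF x h.le hxr).congr_of_eventuallyEq ?_
    filter_upwards [Ioi_mem_nhds h] with y hy using if_pos (le_of_lt hy)

/-- `H` is a solution in the variable `μ = cos θ`, regular at both poles. -/
structure IsRegularSol (m : ℕ) (κ f : ℝ) (H H₁ H₂ : ℝ → ℝ) : Prop where
  deriv : ∀ μ, |μ| < 5 / 4 → HasDerivAt H (H₁ μ) μ
  deriv₁ : ∀ μ, |μ| < 5 / 4 → HasDerivAt H₁ (H₂ μ) μ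
  eq : ∀ μ, |μ| < 5 / 4 → hVal m κ μ (H μ) (H₁ μ) (H₂ μ) = f

/-- The reflection `μ ↦ -μ` exchanges the poles and replaces `κ` by `-κ`, so the second series is in
`1 + μ` with parameter `-κ`; the sign in the derivative condition comes from this reflection. -/
theorem isRegularSol_glue {m : ℕ} {κ f : ℝ} {Y Y₁ Y₂ Z Z₁ Z₂ : ℝ → ℝ}
    (hY : IsLocalSol m κ f Y Y₁ Y₂) (hZ : IsLocalSol m (-κ) f Z Z₁ Z₂)
    (h0 : Y 1 = Z 1) (h1 : Y₁ 1 + Z₁ 1 = 0) :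
    IsRegularSol m κ f (fun μ => if 0 ≤ μ then Y (1 - μ) else Z (1 + μ))
      (fun μ => if 0 ≤ μ then -Y₁ (1 - μ) else Z₁ (1 + μ))
      (fun μ => if 0 ≤ μ then Y₂ (1 - μ) else Z₂ (1 + μ)) := by
  have e1 : ∀ μ : ℝ, 0 ≤ μ → μ < 5 / 4 → |1 - μ| < 5 / 4 := fun μ h h' => by
    rw [abs_lt]; constructor <;> linarith
  have e2 : ∀ μ : ℝ, -(5 / 4) < μ → μ ≤ 0 → |1 + μ| < 5 / 4 := fun μ h h' => by
    rw [abs_lt]; constructor <;> linarith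
  -- At the equator the coefficient of the second derivative is `-1`, so the equation determines it
  -- from the value and first derivative.
  have h2 : Y₂ 1 = Z₂ 1 := by
    have hy := hY.eq 1 (by norm_num)
    have hz := hZ.eq 1 (by norm_num)
    simp only [hVal] at hy hz
    have h1' : Y₁ 1 = -Z₁ 1 := by linarith
    rw [h0, h1'] at hy
    linarith
  refine ⟨fun μ hμ => hasDerivAt_glue (F := fun μ => Y (1 - μ)) (F' := fun μ => -Y₁ (1 - μ))
      (G := fun μ => Z (1 + μ)) (G' := fun μ => Z₁ (1 + μ)) (by norm_num)
      (fun x hx hx' => ?_) (fun x hx hx' => ?_) (by simpa using h0) (by simp; linarith) hμ,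
    fun μ hμ => hasDerivAt_glue (F := fun μ => -Y₁ (1 - μ)) (F' := fun μ => Y₂ (1 - μ))
      (G := fun μ => Z₁ (1 + μ)) (G' := fun μ => Z₂ (1 + μ)) (by norm_num)
      (fun x hx hx' => ?_) (fun x hx hx' => ?_) (by simp; linarith) (by simpa using h2) hμ,
    fun μ hμ => ?_⟩
  · exact ((hY.deriv _ (e1 x hx hx')).comp x ((hasDerivAt_id x).const_sub 1)).congr_deriv (by ring)
  · exact ((hZ.deriv _ (e2 x hx hx')).comp x ((hasDerivAt_id x).const_add 1)).congr_deriv (by ring)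
  · exact ((hY.deriv₁ _ (e1 x hx hx')).comp x ((hasDerivAt_id x).const_sub 1)).neg.congr_deriv
      (by ring)
  · exact ((hZ.deriv₁ _ (e2 x hx hx')).comp x ((hasDerivAt_id x).const_add 1)).congr_deriv
      (by ring)
  · obtain ⟨hl, hr⟩ := abs_lt.mp hμ
    by_cases h : 0 ≤ μ
    · simp only [if_pos h]
      rw [← hY.eq (1 - μ) (e1 μ h hr), sub_sub_cancel]
    · simp only [if_neg h]
      rw [← hZ.eq (1 + μ) (e2 μ hl (le_of_not_ge h))]
      simp only [hVal]
      ring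

theorem abs_cos_lt (θ : ℝ) : |Real.cos θ| < 5 / 4 :=
  (Real.abs_cos_le_one θ).trans_lt (by norm_num)

theorem IsRegularSol.hasDerivAt_sin_mul {m : ℕ} {κ f : ℝ} {H H₁ H₂ : ℝ → ℝ}
    (hH : IsRegularSol m κ f H H₁ H₂) (θ : ℝ) :
    HasDerivAt (fun θ => Real.sin θ * H (Real.cos θ))
      (Real.cos θ * H (Real.cos θ) - Real.sin θ ^ 2 * H₁ (Real.cos θ)) θ := by
  refine ((Real.hasDerivAt_sin θ).mul ((hH.deriv _ (abs_cos_lt θ)).comp θ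
    (Real.hasDerivAt_cos θ))).congr_deriv ?_
  simp only [Function.comp_apply]
  ring

theorem IsRegularSol.hasDerivAt_sin_mul₁ {m : ℕ} {κ f : ℝ} {H H₁ H₂ : ℝ → ℝ}
    (hH : IsRegularSol m κ f H H₁ H₂) (θ : ℝ) :
    HasDerivAt (fun θ => Real.cos θ * H (Real.cos θ) - Real.sin θ ^ 2 * H₁ (Real.cos θ))
      (-Real.sin θ * H (Real.cos θ) - 3 * Real.sin θ * Real.cos θ * H₁ (Real.cos θ) +
        Real.sin θ ^ 3 * H₂ (Real.cos θ)) θ := by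
  refine (((Real.hasDerivAt_cos θ).mul ((hH.deriv _ (abs_cos_lt θ)).comp θ
    (Real.hasDerivAt_cos θ))).sub (((Real.hasDerivAt_sin θ).pow 2).mul
    ((hH.deriv₁ _ (abs_cos_lt θ)).comp θ (Real.hasDerivAt_cos θ)))).congr_deriv ?_
  simp only [Function.comp_apply, Pi.pow_apply, Nat.cast_ofNat, Nat.reduceSub, pow_one]
  ring

theorem ellipticVal_sin_mul (m : ℕ) (κ a b c : ℝ) {θ : ℝ} (hs : Real.sin θ ≠ 0) :
    ellipticVal m κ θ (Real.sin θ * a) (Real.cos θ * a - Real.sin θ ^ 2 * b)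
      (-Real.sin θ * a - 3 * Real.sin θ * Real.cos θ * b + Real.sin θ ^ 3 * c) =
      Real.sin θ * hVal m κ (Real.cos θ) a b c := by
  have h : Real.cos θ ^ 2 = 1 - Real.sin θ ^ 2 := Real.cos_sq' θ
  simp only [ellipticVal, hVal, h]
  field_simp
  linear_combination (-m * a) * h

theorem IsRegularSol.ellipticVal_eq {m : ℕ} {κ f : ℝ} {H H₁ H₂ : ℝ → ℝ}
    (hH : IsRegularSol m κ f H H₁ H₂) {θ : ℝ} (hθ : θ ∈ Set.Ioo 0 Real.pi) :
    ellipticVal m κ θ (Real.sin θ * H (Real.cos θ))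
      (Real.cos θ * H (Real.cos θ) - Real.sin θ ^ 2 * H₁ (Real.cos θ))
      (-Real.sin θ * H (Real.cos θ) - 3 * Real.sin θ * Real.cos θ * H₁ (Real.cos θ) +
        Real.sin θ ^ 3 * H₂ (Real.cos θ)) = Real.sin θ * f := by
  rw [ellipticVal_sin_mul _ _ _ _ _ (Real.sin_pos_of_mem_Ioo hθ).ne',
    hH.eq _ (abs_cos_lt θ)]

theorem IsRegularSol.continuous_comp_cos {m : ℕ} {κ f : ℝ} {H H₁ H₂ : ℝ → ℝ}
    (hH : IsRegularSol m κ f H H₁ H₂) : Continuous fun θ => H (Real.cos θ) :=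
  continuous_iff_continuousAt.mpr fun θ =>
    ContinuousAt.comp (f := Real.cos) (hH.deriv _ (abs_cos_lt θ)).continuousAt
      Real.continuous_cos.continuousAt

theorem IsRegularSol.continuous_comp_cos₁ {m : ℕ} {κ f : ℝ} {H H₁ H₂ : ℝ → ℝ}
    (hH : IsRegularSol m κ f H H₁ H₂) : Continuous fun θ => H₁ (Real.cos θ) :=
  continuous_iff_continuousAt.mpr fun θ =>
    ContinuousAt.comp (f := Real.cos) (hH.deriv₁ _ (abs_cos_lt θ)).continuousAt
      Real.continuous_cos.continuousAt

theorem continuous_sin_rpow {r : ℝ} (hr : 0 ≤ r) : Continuous fun θ => Real.sin θ ^ r :=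
  Real.continuous_sin.rpow_const fun _ => Or.inr hr

theorem IsRegularSol.nonneg_of_zero {m : ℕ} {κ : ℝ} (hκ : 0 < κ) {H H₁ H₂ : ℝ → ℝ}
    (hH : IsRegularSol m κ 0 H H₁ H₂) {θ : ℝ} (hθ : θ ∈ Set.Ioo 0 Real.pi) :
    0 ≤ H (Real.cos θ) := by
  have hcont : Continuous fun θ => Real.sin θ ^ ((m : ℝ) / 2) * (Real.sin θ * H (Real.cos θ)) :=
    (continuous_sin_rpow (by positivity)).mul (Real.continuous_sin.mul hH.continuous_comp_cos)
  have hlim : ∀ x, Real.sin x = 0 → ∀ ε > 0, ∀ᶠ θ in 𝓝 x,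
      -ε < Real.sin θ ^ ((m : ℝ) / 2) * (Real.sin θ * H (Real.cos θ)) := by
    intro x hx ε hε
    have := hcont.tendsto x
    rw [hx, zero_mul, mul_zero] at this
    exact this.eventually (lt_mem_nhds (by linarith))
  have h := nonneg_of_ellipticVal_nonneg m hκ (fun θ _ => hH.hasDerivAt_sin_mul θ)
    (fun θ _ => hH.hasDerivAt_sin_mul₁ θ) (fun θ hθ => by rw [hH.ellipticVal_eq hθ, mul_zero])
    (fun ε hε => nhdsWithin_le_nhds (hlim 0 Real.sin_zero ε hε))
    (fun ε hε => nhdsWithin_le_nhds (hlim _ Real.sin_pi ε hε)) θ hθ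
  exact nonneg_of_mul_nonneg_right h (Real.sin_pos_of_mem_Ioo hθ)

theorem IsRegularSol.eq_zero {m : ℕ} {κ : ℝ} (hκ : 0 < κ) {H H₁ H₂ : ℝ → ℝ}
    (hH : IsRegularSol m κ 0 H H₁ H₂) {μ : ℝ} (hμ : |μ| < 1) : H μ = 0 := by
  have hneg : IsRegularSol m κ 0 (fun μ => -H μ) (fun μ => -H₁ μ) (fun μ => -H₂ μ) :=
    ⟨fun μ hμ => (hH.deriv μ hμ).neg, fun μ hμ => (hH.deriv₁ μ hμ).neg, fun μ hμ => by
      have := hH.eq μ hμ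
      simp only [hVal] at this ⊢
      linarith⟩
  obtain ⟨h1, h2⟩ := abs_lt.mp hμ
  have hθ : Real.arccos μ ∈ Set.Ioo 0 Real.pi :=
    ⟨Real.arccos_pos.mpr h2, lt_of_le_of_ne (Real.arccos_le_pi μ) fun h => by
      rw [Real.arccos_eq_pi] at h; linarith⟩
  have h3 := hH.nonneg_of_zero hκ hθ
  have h4 := hneg.nonneg_of_zero hκ hθ
  simp only [Real.cos_arccos h1.le h2.le] at h3 h4
  linarith

theorem IsLocalSol.eq_zero_of_forall {m : ℕ} {κ f : ℝ} {Y Y₁ Y₂ : ℝ → ℝ}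
    (hY : IsLocalSol m κ f Y Y₁ Y₂) {a : ℝ} (h : ∀ s, 0 < s → s < 1 → a * Y s = 0) :
    a * Y 0 = 0 := by
  have hc : Tendsto (fun s => a * Y s) (𝓝[>] 0) (𝓝 (a * Y 0)) :=
    ((hY.deriv 0 (by norm_num)).continuousAt.tendsto.const_mul a).mono_left nhdsWithin_le_nhds
  have h0 : Tendsto (fun s => a * Y s) (𝓝[>] 0) (𝓝 0) := by
    refine tendsto_const_nhds.congr' ?_
    filter_upwards [Ioo_mem_nhdsGT one_pos] with s hs using (h s hs.1 hs.2).symm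
  exact tendsto_nhds_unique hc h0

/-- Matching value and derivative at the equator is a linear system for the two free leading
coefficients. A kernel element gives a regular homogeneous solution, which vanishes by the maximum
principle; injectivity in dimension two then gives surjectivity. -/
theorem exists_isRegularSol (m : ℕ) {κ : ℝ} (hκ : 0 < κ) (f : ℝ) :
    ∃ H H₁ H₂, IsRegularSol m κ f H H₁ H₂ := by
  obtain ⟨U, U₁, U₂, hU, hU0⟩ := exists_isLocalSol m κ 0 1
  obtain ⟨V, V₁, V₂, hV, hV0⟩ := exists_isLocalSol m (-κ) 0 1
  obtain ⟨P, P₁, P₂, hP, -⟩ := exists_isLocalSol m κ f 0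
  obtain ⟨Q, Q₁, Q₂, hQ, -⟩ := exists_isLocalSol m (-κ) f 0
  -- The zero solution lets the scalar multiples `α U` and `β V` be formed with
  -- `IsLocalSol.lincomb`.
  obtain ⟨O, O₁, O₂, hO, hO'⟩ : ∃ O O₁ O₂ : ℝ → ℝ, (∀ κ, IsLocalSol m κ 0 O O₁ O₂) ∧
      ∀ s, O s = 0 ∧ O₁ s = 0 :=
    ⟨fun _ => 0, fun _ => 0, fun _ => 0, fun κ => ⟨fun s _ => hasDerivAt_const s 0,
      fun s _ => hasDerivAt_const s 0, fun s _ => by simp [hVal]⟩, fun s => ⟨rfl, rfl⟩⟩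
  let T : (ℝ × ℝ) →ₗ[ℝ] (ℝ × ℝ) :=
    { toFun := fun p => (p.1 * U 1 - p.2 * V 1, p.1 * U₁ 1 + p.2 * V₁ 1)
      map_add' := fun p q => by ext <;> simp <;> ring
      map_smul' := fun c p => by ext <;> simp <;> ring }
  have hinj : Function.Injective T := by
    rw [← LinearMap.ker_eq_bot, LinearMap.ker_eq_bot']
    rintro ⟨α, β⟩ hT
    have hT1 : α * U 1 - β * V 1 = 0 := congrArg Prod.fst hT
    have hT2 : α * U₁ 1 + β * V₁ 1 = 0 := congrArg Prod.snd hT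
    have hA := (hO κ).lincomb hU α
    have hB := (hO (-κ)).lincomb hV β
    rw [mul_zero, add_zero] at hA hB
    have hG := isRegularSol_glue hA hB (by simp only [hO']; linarith)
      (by simp only [hO']; linarith)
    have hα := hU.eq_zero_of_forall (a := α) fun s h1 h2 => by
      have := hG.eq_zero hκ (μ := 1 - s) (by rw [abs_lt]; constructor <;> linarith)
      simpa [h2.le, (hO' _).1] using this
    have hβ := hV.eq_zero_of_forall (a := β) fun s h1 h2 => by
      have := hG.eq_zero hκ (μ := s - 1) (by rw [abs_lt]; constructor <;> linarith)
      simpa [h2.not_ge, (hO' _).1] using this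
    rw [hU0, mul_one] at hα
    rw [hV0, mul_one] at hβ
    rw [hα, hβ]
    rfl
  obtain ⟨⟨α, β⟩, hT⟩ := (LinearMap.injective_iff_surjective.mp hinj)
    (Q 1 - P 1, -(P₁ 1 + Q₁ 1))
  have hT1 : α * U 1 - β * V 1 = Q 1 - P 1 := congrArg Prod.fst hT
  have hT2 : α * U₁ 1 + β * V₁ 1 = -(P₁ 1 + Q₁ 1) := congrArg Prod.snd hT
  have hA := hP.lincomb hU α
  have hB := hQ.lincomb hV β
  rw [mul_zero, add_zero] at hA hB
  exact ⟨_, _, _, isRegularSol_glue hA hB (by linarith) (by linarith)⟩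

theorem ellipticOp_eq_ellipticVal (m : ℕ) (κ : ℝ) {g g₁ : ℝ → ℝ} {g₂ θ : ℝ}
    (hθ : θ ∈ Set.Ioo 0 Real.pi) (hg : ∀ t ∈ Set.Ioo 0 Real.pi, HasDerivAt g (g₁ t) t)
    (hg₁ : HasDerivAt g₁ g₂ θ) :
    ellipticOp (m + 2) κ g θ = ellipticVal m κ θ (g θ) (g₁ θ) g₂ := by
  have hs := Real.sin_pos_of_mem_Ioo hθ
  have hev : (fun t => Real.sin t ^ m * Real.exp (κ * Real.cos t) * deriv g t) =ᶠ[𝓝 θ]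
      fun t => Real.sin t ^ m * Real.exp (κ * Real.cos t) * g₁ t := by
    filter_upwards [Ioo_mem_nhds hθ.1 hθ.2] with t ht
    rw [(hg t ht).deriv]
  have hd := ((((Real.hasDerivAt_sin θ).pow m).mul
    ((Real.hasDerivAt_cos θ).const_mul κ).exp).mul hg₁)
  have hd' := hd.deriv
  rw [ellipticOp, Nat.add_sub_cancel, hev.deriv_eq]
  simp only [Pi.mul_def, Pi.pow_apply] at hd'
  rw [hd', ellipticVal]
  have hm : (m : ℝ) * Real.sin θ ^ (m - 1) * Real.sin θ = m * Real.sin θ ^ m := by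
    cases m with
    | zero => simp
    | succ m => simp [pow_succ, mul_assoc]
  have hm' : (m : ℝ) * Real.sin θ ^ (m - 1) = m * Real.sin θ ^ m / Real.sin θ := by
    rw [← hm]
    field_simp
  rw [hm']
  push_cast
  field_simp
  ring

theorem contDiffOn_two_of_hasDerivAt {g g₁ g₂ : ℝ → ℝ} {s : Set ℝ} (hs : IsOpen s)
    (hg : ∀ t ∈ s, HasDerivAt g (g₁ t) t) (hg₁ : ∀ t ∈ s, HasDerivAt g₁ (g₂ t) t)
    (hg₂ : ContinuousOn g₂ s) : ContDiffOn ℝ 2 g s := by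
  have hone : ContDiffOn ℝ 1 g₁ s := by
    rw [show (1 : WithTop ℕ∞) = 0 + 1 from rfl, contDiffOn_succ_iff_deriv_of_isOpen hs]
    refine ⟨fun t ht => (hg₁ t ht).differentiableAt.differentiableWithinAt, by simp, ?_⟩
    rw [contDiffOn_zero]
    exact hg₂.congr fun t ht => (hg₁ t ht).deriv
  rw [show (2 : WithTop ℕ∞) = 1 + 1 from rfl, contDiffOn_succ_iff_deriv_of_isOpen hs]
  exact ⟨fun t ht => (hg t ht).differentiableAt.differentiableWithinAt, by simp,
    hone.congr fun t ht => (hg t ht).deriv⟩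

theorem memL2_of_continuous {u v : ℝ → ℝ} (hv : Continuous v)
    (huv : ∀ θ ∈ Set.Ioo 0 Real.pi, u θ = v θ) : MemL2 u := by
  obtain ⟨C, hC⟩ := isCompact_Icc.exists_bound_of_continuousOn
    (hv.continuousOn (s := Set.Icc 0 Real.pi))
  have hvL : MemL2 v := MemLp.of_bound hv.aestronglyMeasurable C
    ((ae_restrict_iff' measurableSet_Ioo).mpr
      (Eventually.of_forall fun θ hθ => hC θ (Set.Ioo_subset_Icc_self hθ)))
  exact (memLp_congr_ae ((ae_restrict_iff' measurableSet_Ioo).mpr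
    (Eventually.of_forall huv))).mpr hvL

theorem IsRegularSol.isGCI {m : ℕ} {κ : ℝ} {H H₁ H₂ : ℝ → ℝ}
    (hH : IsRegularSol m κ 1 H H₁ H₂) :
    IsGCI (m + 2) κ fun θ => Real.sin θ * H (Real.cos θ) := by
  have hH0 := hH.continuous_comp_cos
  have hH1 := hH.continuous_comp_cos₁
  have hcont₁ : Continuous fun θ =>
      Real.cos θ * H (Real.cos θ) - Real.sin θ ^ 2 * H₁ (Real.cos θ) :=
    (Real.continuous_cos.mul hH0).sub ((Real.continuous_sin.pow 2).mul hH1)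
  have hu : ∀ θ ∈ Set.Ioo 0 Real.pi,
      Real.sin θ ^ (((m + 2 : ℕ) : ℝ) / 2 - 1) * (Real.sin θ * H (Real.cos θ)) =
        Real.sin θ ^ ((m : ℝ) / 2 + 1) * H (Real.cos θ) := by
    intro θ hθ
    have hs := Real.sin_pos_of_mem_Ioo hθ
    rw [Real.rpow_add_one hs.ne']
    push_cast
    rw [show ((m : ℝ) + 2) / 2 - 1 = m / 2 by ring]
    ring
  have hucont : Continuous fun θ => Real.sin θ ^ ((m : ℝ) / 2 + 1) * H (Real.cos θ) :=
    (continuous_sin_rpow (by positivity)).mul hH0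
  have hlim : ∀ x, Real.sin x = 0 →
      Tendsto (fun θ => Real.sin θ ^ ((m : ℝ) / 2 + 1) * H (Real.cos θ)) (𝓝 x) (𝓝 0) := by
    intro x hx
    have := hucont.tendsto x
    rwa [hx, Real.zero_rpow (by positivity), zero_mul] at this
  refine ⟨?_, ⟨?_, ?_, ?_, ?_, ?_⟩, fun θ hθ => ?_⟩
  · refine contDiffOn_two_of_hasDerivAt isOpen_Ioo (fun θ _ => hH.hasDerivAt_sin_mul θ)
      (fun θ _ => hH.hasDerivAt_sin_mul₁ θ) ?_
    -- Continuity of `H₂` is not recorded in `IsRegularSol`; the second derivative of `g` is instead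
    -- read off from the equation.
    have h2 : ContinuousOn (fun θ => m / Real.sin θ ^ 2 * (Real.sin θ * H (Real.cos θ)) -
        (m * Real.cos θ / Real.sin θ - κ * Real.sin θ) *
        (Real.cos θ * H (Real.cos θ) - Real.sin θ ^ 2 * H₁ (Real.cos θ)) - Real.sin θ * 1)
        (Set.Ioo 0 Real.pi) := by
      have hne : ∀ θ ∈ Set.Ioo 0 Real.pi, Real.sin θ ≠ 0 := fun θ hθ =>
        (Real.sin_pos_of_mem_Ioo hθ).ne'
      have hne2 : ∀ θ ∈ Set.Ioo 0 Real.pi, Real.sin θ ^ 2 ≠ 0 := fun θ hθ =>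
        pow_ne_zero 2 (hne θ hθ)
      have hA : ContinuousOn (fun θ => (m : ℝ) / Real.sin θ ^ 2) (Set.Ioo 0 Real.pi) :=
        continuousOn_const.div (by fun_prop) hne2
      have hB : ContinuousOn (fun θ => m * Real.cos θ / Real.sin θ) (Set.Ioo 0 Real.pi) :=
        ContinuousOn.div (by fun_prop) (by fun_prop) hne
      exact ((hA.mul (Real.continuous_sin.mul hH0).continuousOn).sub
        ((hB.sub (by fun_prop)).mul hcont₁.continuousOn)).sub (by fun_prop)
    refine h2.congr fun θ hθ => ?_
    have := hH.ellipticVal_eq hθ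
    rw [ellipticVal] at this
    linear_combination -this
  · refine memL2_of_continuous
      (v := fun θ => (m : ℝ) * (Real.sin θ ^ ((m : ℝ) / 2) * H (Real.cos θ)))
      (((continuous_sin_rpow (by positivity)).mul hH0).const_mul _) fun θ hθ => ?_
    have hs := Real.sin_pos_of_mem_Ioo hθ
    rw [show ((m : ℝ) / 2) = ((m + 2 : ℕ) : ℝ) / 2 - 2 + 1 by push_cast; ring,
      Real.rpow_add_one hs.ne']
    push_cast
    ring
  · exact memL2_of_continuous hucont hu
  · refine memL2_of_continuous (v := fun θ =>
      ((m : ℝ) / 2 + 1) * Real.sin θ ^ ((m : ℝ) / 2) * Real.cos θ * H (Real.cos θ) -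
        Real.sin θ ^ ((m : ℝ) / 2 + 1) * Real.sin θ * H₁ (Real.cos θ)) ?_ fun θ hθ => ?_
    · have h1 := continuous_sin_rpow (r := (m : ℝ) / 2) (by positivity)
      have h2 := continuous_sin_rpow (r := (m : ℝ) / 2 + 1) (by positivity)
      exact (((h1.const_mul _).mul Real.continuous_cos).mul hH0).sub
        ((h2.mul Real.continuous_sin).mul hH1)
    · have hs := Real.sin_pos_of_mem_Ioo hθ
      have hev : (fun θ => Real.sin θ ^ (((m + 2 : ℕ) : ℝ) / 2 - 1) *
          (Real.sin θ * H (Real.cos θ))) =ᶠ[𝓝 θ]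
          fun θ => Real.sin θ ^ ((m : ℝ) / 2 + 1) * H (Real.cos θ) := by
        filter_upwards [Ioo_mem_nhds hθ.1 hθ.2] with t ht using hu t ht
      rw [hev.deriv_eq]
      have hd := ((Real.hasDerivAt_sin θ).rpow_const (p := (m : ℝ) / 2 + 1) (Or.inl hs.ne')).mul
        ((hH.deriv _ (abs_cos_lt θ)).comp θ (Real.hasDerivAt_cos θ))
      have hd' := hd.deriv
      simp only [Pi.mul_def, Function.comp_apply] at hd'
      rw [hd', add_sub_cancel_right]
      ring
  · refine ((hlim 0 Real.sin_zero).mono_left nhdsWithin_le_nhds).congr' ?_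
    filter_upwards [Ioo_mem_nhdsGT Real.pi_pos] with θ hθ using (hu θ hθ).symm
  · refine ((hlim _ Real.sin_pi).mono_left nhdsWithin_le_nhds).congr' ?_
    filter_upwards [Ioo_mem_nhdsLT Real.pi_pos] with θ hθ using (hu θ hθ).symm
  · rw [ellipticOp_eq_ellipticVal m κ hθ (fun t _ => hH.hasDerivAt_sin_mul t)
      (hH.hasDerivAt_sin_mul₁ θ), hH.ellipticVal_eq hθ, mul_one]

theorem isGCI_gciG (m : ℕ) {κ : ℝ} (hκ : 0 < κ) : IsGCI (m + 2) κ (gciG (m + 2) κ) := by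
  obtain ⟨H, H₁, H₂, hH⟩ := exists_isRegularSol m hκ 1
  exact Classical.epsilon_spec (p := IsGCI (m + 2) κ) ⟨_, hH.isGCI⟩

/-! ### Asymptotics of `c̃` -/

section GCIBounds

variable {m : ℕ} {κ : ℝ} {g : ℝ → ℝ}

theorem IsGCI.hasDerivAt (hg : IsGCI (m + 2) κ g) {θ : ℝ} (hθ : θ ∈ Set.Ioo 0 Real.pi) :
    HasDerivAt g (deriv g θ) θ :=
  ((hg.smooth.differentiableOn (by norm_num)).differentiableAt
    (Ioo_mem_nhds hθ.1 hθ.2)).hasDerivAt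

theorem IsGCI.hasDerivAt_deriv (hg : IsGCI (m + 2) κ g) {θ : ℝ} (hθ : θ ∈ Set.Ioo 0 Real.pi) :
    HasDerivAt (deriv g) (deriv (deriv g) θ) θ :=
  (((hg.smooth.deriv_of_isOpen (m := 1) isOpen_Ioo (by norm_num)).differentiableOn
    (by norm_num)).differentiableAt (Ioo_mem_nhds hθ.1 hθ.2)).hasDerivAt

theorem IsGCI.ellipticVal_eq (hg : IsGCI (m + 2) κ g) {θ : ℝ} (hθ : θ ∈ Set.Ioo 0 Real.pi) :
    ellipticVal m κ θ (g θ) (deriv g θ) (deriv (deriv g) θ) = Real.sin θ := by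
  rw [← ellipticOp_eq_ellipticVal m κ hθ (fun t ht => hg.hasDerivAt ht) (hg.hasDerivAt_deriv hθ)]
  exact hg.equation θ hθ

theorem IsGCI.tendsto_zero (hg : IsGCI (m + 2) κ g) :
    Tendsto (fun θ => Real.sin θ ^ ((m : ℝ) / 2) * g θ) (𝓝[>] 0) (𝓝 0) := by
  have := hg.memV.memH10.tendsto_zero
  rwa [show ((m + 2 : ℕ) : ℝ) / 2 - 1 = m / 2 by push_cast; ring] at this

theorem IsGCI.tendsto_pi (hg : IsGCI (m + 2) κ g) :
    Tendsto (fun θ => Real.sin θ ^ ((m : ℝ) / 2) * g θ) (𝓝[<] Real.pi) (𝓝 0) := by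
  have := hg.memV.memH10.tendsto_pi
  rwa [show ((m + 2 : ℕ) : ℝ) / 2 - 1 = m / 2 by push_cast; ring] at this

/-- Comparison with the supersolution `θ / (κ + 2m/3)`. -/
theorem IsGCI.le_upper (hκ : 0 < κ) (hg : IsGCI (m + 2) κ g) {θ : ℝ}
    (hθ : θ ∈ Set.Ioo 0 Real.pi) : g θ ≤ θ / (κ + 2 * m / 3) := by
  set l := κ + 2 * m / 3 with hl
  have hl0 : 0 < l := by positivity
  have hb : ∀ θ ∈ Set.Ioo 0 Real.pi, ∀ ε : ℝ, Real.sin θ ^ ((m : ℝ) / 2) * g θ < ε →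
      -ε < Real.sin θ ^ ((m : ℝ) / 2) * (θ / l - g θ) := by
    intro θ hθ ε h
    have hs := Real.sin_pos_of_mem_Ioo hθ
    have : 0 < Real.sin θ ^ ((m : ℝ) / 2) * (θ / l) := by
      have := hθ.1
      positivity
    rw [mul_sub]
    linarith
  have h := nonneg_of_ellipticVal_nonneg m hκ (u := fun θ => θ / l - g θ)
    (u₁ := fun θ => 1 / l - deriv g θ) (u₂ := fun θ => 0 - deriv (deriv g) θ)
    (fun θ hθ => ((hasDerivAt_id θ).div_const l).sub (hg.hasDerivAt hθ))
    (fun θ hθ => (hasDerivAt_const θ (1 / l)).sub (hg.hasDerivAt_deriv hθ))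
    (fun θ hθ => by
      have h1 := mul_sin_le_ellipticVal_id m κ hθ
      have h2 := hg.ellipticVal_eq hθ
      have h3 : ellipticVal m κ θ (θ / l - g θ) (1 / l - deriv g θ) (0 - deriv (deriv g) θ) =
          ellipticVal m κ θ θ 1 0 / l -
            ellipticVal m κ θ (g θ) (deriv g θ) (deriv (deriv g) θ) := by
        simp only [ellipticVal]
        ring
      rw [← hl] at h1
      rw [h3, h2, sub_nonneg, le_div_iff₀ hl0]
      linarith)
    (fun ε hε => by
      filter_upwards [hg.tendsto_zero.eventually (gt_mem_nhds hε), Ioo_mem_nhdsGT Real.pi_pos]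
        with θ h1 h2 using hb θ h2 ε h1)
    (fun ε hε => by
      filter_upwards [hg.tendsto_pi.eventually (gt_mem_nhds hε), Ioo_mem_nhdsLT Real.pi_pos]
        with θ h1 h2 using hb θ h2 ε h1) θ hθ
  exact sub_nonneg.mp h

/-- With `s = 1 - cos θ`, the subsolution is a multiple of `sin θ (1 + s/3)`, which agrees with `θ`
to third order at `0`. The slope `1/3` also removes the term in `κ s` from the operator, so the
normalisation differs from that of the upper bound only by `O(1/κ)`. -/
theorem IsGCI.lower_le (hκ : 0 < κ) (hg : IsGCI (m + 2) κ g) {θ : ℝ}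
    (hθ : θ ∈ Set.Ioo 0 Real.pi) :
    Real.sin θ * ((4 - Real.cos θ) / 3) / (κ + 2 * m / 3 + (m + 2) ^ 2 / (6 * κ)) ≤ g θ := by
  set l := κ + 2 * m / 3 + (m + 2) ^ 2 / (6 * κ) with hl
  have hl0 : 0 < l := by positivity
  have hlim : ∀ x, Real.sin x = 0 → Tendsto
      (fun θ => Real.sin θ ^ ((m : ℝ) / 2) * (Real.sin θ * ((4 - Real.cos θ) / 3) / l))
      (𝓝 x) (𝓝 0) := by
    intro x hx
    have : Continuous fun θ =>
        Real.sin θ ^ ((m : ℝ) / 2) * (Real.sin θ * ((4 - Real.cos θ) / 3) / l) :=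
      (continuous_sin_rpow (by positivity)).mul (by fun_prop)
    have := this.tendsto x
    rwa [hx, zero_mul, zero_div, mul_zero] at this
  have h := nonneg_of_ellipticVal_nonneg m hκ
    (u := fun θ => g θ - Real.sin θ * ((4 - Real.cos θ) / 3) / l)
    (u₁ := fun θ => deriv g θ -
      (Real.cos θ * ((4 - Real.cos θ) / 3) - Real.sin θ ^ 2 * (-1 / 3)) / l)
    (u₂ := fun θ => deriv (deriv g) θ -
      (-Real.sin θ * ((4 - Real.cos θ) / 3) - 3 * Real.sin θ * Real.cos θ * (-1 / 3) +
        Real.sin θ ^ 3 * 0) / l)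
    (fun θ hθ => by
      refine (hg.hasDerivAt hθ).sub ((((Real.hasDerivAt_sin θ).mul
        (((Real.hasDerivAt_cos θ).const_sub 4).div_const 3)).div_const l).congr_deriv ?_)
      ring)
    (fun θ hθ => by
      refine (hg.hasDerivAt_deriv hθ).sub (((((Real.hasDerivAt_cos θ).mul
        (((Real.hasDerivAt_cos θ).const_sub 4).div_const 3)).sub
        (((Real.hasDerivAt_sin θ).pow 2).mul_const (-1 / 3))).div_const l).congr_deriv ?_)
      simp only [Nat.cast_ofNat, Nat.reduceSub, pow_one]
      ring)
    (fun θ hθ => by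
      have hs := Real.sin_pos_of_mem_Ioo hθ
      have h1 := hg.ellipticVal_eq hθ
      have h2 := ellipticVal_sin_mul m κ ((4 - Real.cos θ) / 3) (-1 / 3) 0 hs.ne'
      have h3 : hVal m κ (Real.cos θ) ((4 - Real.cos θ) / 3) (-1 / 3) 0 ≤ l := by
        -- Completing the square in `1 - cos θ`; the maximum is the constant `(m + 2)² / (6 κ)` in
        -- `l`.
        have h4 : hVal m κ (Real.cos θ) ((4 - Real.cos θ) / 3) (-1 / 3) 0 =
            l - (m + 2 - 2 * κ * (1 - Real.cos θ)) ^ 2 / (6 * κ) := by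
          rw [hVal, hl]
          field_simp
          ring
        have h5 : 0 ≤ (m + 2 - 2 * κ * (1 - Real.cos θ)) ^ 2 / (6 * κ) := by positivity
        linarith
      have h6 : Real.sin θ * hVal m κ (Real.cos θ) ((4 - Real.cos θ) / 3) (-1 / 3) 0 / l ≤
          Real.sin θ := by
        rw [div_le_iff₀ hl0]
        gcongr
      rw [← h2] at h6
      refine (sub_nonneg.mpr h6).trans_eq ?_
      nth_rewrite 1 [← h1]
      simp only [ellipticVal]
      ring)
    (fun ε hε => by
      have := hg.tendsto_zero.sub ((hlim 0 Real.sin_zero).mono_left nhdsWithin_le_nhds)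
      simp only [← mul_sub] at this
      exact this.eventually (lt_mem_nhds (by linarith)))
    (fun ε hε => by
      have := hg.tendsto_pi.sub ((hlim _ Real.sin_pi).mono_left nhdsWithin_le_nhds)
      simp only [← mul_sub] at this
      exact this.eventually (lt_mem_nhds (by linarith))) θ hθ
  exact sub_nonneg.mp h

theorem IsGCI.nonneg (hκ : 0 < κ) (hg : IsGCI (m + 2) κ g) {θ : ℝ}
    (hθ : θ ∈ Set.Ioo 0 Real.pi) : 0 ≤ g θ := by
  refine le_trans ?_ (hg.lower_le hκ hθ)
  have hs := Real.sin_pos_of_mem_Ioo hθ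
  have : 0 ≤ 4 - Real.cos θ := by linarith [Real.cos_le_one θ]
  positivity

/-- The moments of `1 - cos θ` weighted by a generalized collisional invariant. -/
noncomputable def gciMoment (m : ℕ) (κ : ℝ) (g : ℝ → ℝ) (k : ℕ) : ℝ :=
  ∫ θ in (0 : ℝ)..Real.pi,
    (1 - Real.cos θ) ^ k * Real.sin θ ^ (m + 1) * Real.exp (κ * Real.cos θ) * g θ

theorem IsGCI.intervalIntegrable (hκ : 0 < κ) (hg : IsGCI (m + 2) κ g) (k : ℕ) :
    IntervalIntegrable (fun θ => (1 - Real.cos θ) ^ k * Real.sin θ ^ (m + 1) *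
      Real.exp (κ * Real.cos θ) * g θ) volume 0 Real.pi := by
  rw [intervalIntegrable_iff_integrableOn_Ioo_of_le Real.pi_pos.le]
  have hc : ContinuousOn (fun θ => (1 - Real.cos θ) ^ k * Real.sin θ ^ (m + 1) *
      Real.exp (κ * Real.cos θ) * g θ) (Set.Ioo 0 Real.pi) :=
    ContinuousOn.mul (by fun_prop) hg.smooth.continuousOn
  have hb : Continuous fun θ => |(1 - Real.cos θ) ^ k * Real.sin θ ^ (m + 1) *
      Real.exp (κ * Real.cos θ)| * (θ / (κ + 2 * m / 3)) := by fun_prop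
  refine Integrable.mono' (g := fun θ => |(1 - Real.cos θ) ^ k * Real.sin θ ^ (m + 1) *
      Real.exp (κ * Real.cos θ)| * (θ / (κ + 2 * m / 3))) ?_
    (hc.aestronglyMeasurable measurableSet_Ioo) ?_
  · exact hb.integrableOn_Icc.mono_set Set.Ioo_subset_Icc_self
  · refine (ae_restrict_iff' measurableSet_Ioo).mpr (Eventually.of_forall fun θ hθ => ?_)
    rw [Real.norm_eq_abs, abs_mul, abs_of_nonneg (hg.nonneg hκ hθ)]
    gcongr
    exact hg.le_upper hκ hθ

/-- In the half angle `t = θ/2` this becomes `t cos t ≤ sin t - sin³ t / 3`, and the difference of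
the two sides has derivative `sin t (t - sin t cos t) ≥ 0`. -/
theorem mul_sin_le_one_sub_cos {θ : ℝ} (h0 : 0 ≤ θ) (hpi : θ ≤ Real.pi) :
    θ * Real.sin θ ≤ 2 * (1 - Real.cos θ) - (1 - Real.cos θ) ^ 2 / 3 := by
  have hmono : MonotoneOn (fun t => Real.sin t - Real.sin t ^ 3 / 3 - t * Real.cos t)
      (Set.Icc 0 (Real.pi / 2)) := by
    refine monotoneOn_of_deriv_nonneg (convex_Icc _ _) (by fun_prop) (by fun_prop) fun t ht => ?_
    rw [interior_Icc] at ht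
    have hd : HasDerivAt (fun t => Real.sin t - Real.sin t ^ 3 / 3 - t * Real.cos t)
        (Real.sin t * (t - Real.sin t * Real.cos t)) t := by
      refine (((Real.hasDerivAt_sin t).sub (((Real.hasDerivAt_sin t).pow 3).div_const 3)).sub
        ((hasDerivAt_id t).mul (Real.hasDerivAt_cos t))).congr_deriv ?_
      simp only [Nat.cast_ofNat, Nat.reduceSub, id]
      ring
    rw [hd.deriv]
    have h1 := Real.sin_pos_of_mem_Ioo ⟨ht.1, by linarith [ht.2, Real.pi_pos]⟩
    have h2 := Real.sin_lt ht.1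
    have h3 := Real.cos_le_one t
    exact mul_nonneg h1.le (by nlinarith)
  have h := hmono (show (0 : ℝ) ∈ Set.Icc 0 (Real.pi / 2) from ⟨le_rfl, by positivity⟩)
    (show θ / 2 ∈ Set.Icc 0 (Real.pi / 2) from ⟨by positivity, by linarith⟩) (by positivity)
  simp only [Real.sin_zero, zero_mul] at h
  have hs : 0 ≤ Real.sin (θ / 2) :=
    Real.sin_nonneg_of_nonneg_of_le_pi (by positivity) (by linarith [Real.pi_pos])
  have e1 : Real.sin θ = 2 * Real.sin (θ / 2) * Real.cos (θ / 2) := by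
    rw [← Real.sin_two_mul]; ring_nf
  have e2 : 1 - Real.cos θ = 2 * Real.sin (θ / 2) ^ 2 := by
    have := Real.cos_two_mul (θ / 2)
    rw [mul_div_cancel₀ θ two_ne_zero] at this
    rw [this, Real.sin_sq]
    ring
  rw [e1, e2]
  nlinarith [mul_nonneg hs (show 0 ≤ Real.sin (θ / 2) - Real.sin (θ / 2) ^ 3 / 3 -
    θ / 2 * Real.cos (θ / 2) by linarith)]

theorem IsGCI.gciMoment_le (hκ : 0 < κ) (hg : IsGCI (m + 2) κ g) (k : ℕ) :
    (κ + 2 * m / 3) * gciMoment m κ g k ≤ 2 * moment m (k + 1) κ - moment m (k + 2) κ / 3 := by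
  have hl0 : 0 < κ + 2 * m / 3 := by positivity
  rw [gciMoment, moment, moment, ← intervalIntegral.integral_const_mul,
    ← intervalIntegral.integral_const_mul, ← intervalIntegral.integral_div,
    ← intervalIntegral.integral_sub (Continuous.intervalIntegrable (by fun_prop) _ _)
      (Continuous.intervalIntegrable (by fun_prop) _ _)]
  refine intervalIntegral.integral_mono_on_of_le_Ioo Real.pi_pos.le
    ((hg.intervalIntegrable hκ k).const_mul _)
    (Continuous.intervalIntegrable (by fun_prop) _ _) fun θ hθ => ?_
  have hs := Real.sin_pos_of_mem_Ioo hθ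
  have h0 := one_sub_cos_pos hθ
  have h1 := hg.le_upper hκ hθ
  rw [le_div_iff₀ hl0] at h1
  have h2 := mul_sin_le_one_sub_cos hθ.1.le hθ.2.le
  calc _ = (1 - Real.cos θ) ^ k * Real.sin θ ^ m * Real.exp (κ * Real.cos θ) *
        (g θ * (κ + 2 * m / 3) * Real.sin θ) := by ring
    _ ≤ (1 - Real.cos θ) ^ k * Real.sin θ ^ m * Real.exp (κ * Real.cos θ) *
        (2 * (1 - Real.cos θ) - (1 - Real.cos θ) ^ 2 / 3) := by
      gcongr
      refine le_trans ?_ h2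
      gcongr
    _ = _ := by ring

/-- With `s = 1 - cos θ`, `sin² θ (4 - cos θ) / 3 = 2 s - s²/3 - s³/3` exactly, so the two bounds on
the weighted moments differ only in the `s³` term and the normalisation. -/
theorem IsGCI.le_gciMoment (hκ : 0 < κ) (hg : IsGCI (m + 2) κ g) (k : ℕ) :
    2 * moment m (k + 1) κ - moment m (k + 2) κ / 3 - moment m (k + 3) κ / 3 ≤
      (κ + 2 * m / 3 + (m + 2) ^ 2 / (6 * κ)) * gciMoment m κ g k := by
  have hl0 : 0 < κ + 2 * m / 3 + (m + 2) ^ 2 / (6 * κ) := by positivity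
  rw [gciMoment, moment, moment, moment, ← intervalIntegral.integral_const_mul,
    ← intervalIntegral.integral_const_mul, ← intervalIntegral.integral_div,
    ← intervalIntegral.integral_div,
    ← intervalIntegral.integral_sub (Continuous.intervalIntegrable (by fun_prop) _ _)
      (Continuous.intervalIntegrable (by fun_prop) _ _),
    ← intervalIntegral.integral_sub (Continuous.intervalIntegrable (by fun_prop) _ _)
      (Continuous.intervalIntegrable (by fun_prop) _ _)]
  refine intervalIntegral.integral_mono_on_of_le_Ioo Real.pi_pos.le
    (Continuous.intervalIntegrable (by fun_prop) _ _)
    ((hg.intervalIntegrable hκ k).const_mul _) fun θ hθ => ?_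
  have hs := Real.sin_pos_of_mem_Ioo hθ
  have h0 := one_sub_cos_pos hθ
  have h1 := hg.lower_le hκ hθ
  rw [div_le_iff₀ hl0] at h1
  have h2 : Real.sin θ * Real.sin θ = (1 - Real.cos θ) * (1 + Real.cos θ) := by
    rw [← sq, Real.sin_sq]
    ring
  calc _ = (1 - Real.cos θ) ^ k * Real.sin θ ^ m * Real.exp (κ * Real.cos θ) *
        ((1 - Real.cos θ) * (1 + Real.cos θ) * ((4 - Real.cos θ) / 3)) := by ring
    _ = (1 - Real.cos θ) ^ k * Real.sin θ ^ m * Real.exp (κ * Real.cos θ) *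
        (Real.sin θ * ((4 - Real.cos θ) / 3) * Real.sin θ) := by
      rw [← h2]
      ring
    _ ≤ (1 - Real.cos θ) ^ k * Real.sin θ ^ m * Real.exp (κ * Real.cos θ) *
        (g θ * (κ + 2 * m / 3 + (m + 2) ^ 2 / (6 * κ)) * Real.sin θ) := by gcongr
    _ = _ := by ring

end GCIBounds

/-! ### Second-order expansion of `c̃` from the weighted moments. -/

theorem gciH_cos_mul_sin_pow (m : ℕ) (κ : ℝ) {θ : ℝ} (hθ : θ ∈ Set.Icc 0 Real.pi) :
    gciH (m + 2) κ (Real.cos θ) * Real.sin θ ^ (m + 2) =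
      gciG (m + 2) κ θ * Real.sin θ ^ (m + 1) := by
  rw [gciH, Real.arccos_cos hθ.1 hθ.2]
  by_cases h : Real.sin θ = 0
  · simp [h]
  · field_simp
    ring

theorem one_sub_cTilde_eq (m : ℕ) {κ : ℝ} (hκ : 0 < κ)
    (h0 : gciMoment m κ (gciG (m + 2) κ) 0 ≠ 0) :
    1 - cTilde (m + 2) κ =
      gciMoment m κ (gciG (m + 2) κ) 1 / gciMoment m κ (gciG (m + 2) κ) 0 := by
  have hg := isGCI_gciG m hκ
  have hden : ∫ θ in (0 : ℝ)..Real.pi,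
      gciH (m + 2) κ (Real.cos θ) * Real.exp (κ * Real.cos θ) * Real.sin θ ^ (m + 2) =
      gciMoment m κ (gciG (m + 2) κ) 0 := by
    refine intervalIntegral.integral_congr fun θ hθ => ?_
    rw [Set.uIcc_of_le Real.pi_pos.le] at hθ
    have := gciH_cos_mul_sin_pow m κ hθ
    linear_combination Real.exp (κ * Real.cos θ) * this
  have hnum : ∫ θ in (0 : ℝ)..Real.pi, Real.cos θ *
      gciH (m + 2) κ (Real.cos θ) * Real.exp (κ * Real.cos θ) * Real.sin θ ^ (m + 2) =
      gciMoment m κ (gciG (m + 2) κ) 0 - gciMoment m κ (gciG (m + 2) κ) 1 := by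
    rw [gciMoment, gciMoment, ← intervalIntegral.integral_sub (hg.intervalIntegrable hκ 0)
      (hg.intervalIntegrable hκ 1)]
    refine intervalIntegral.integral_congr fun θ hθ => ?_
    rw [Set.uIcc_of_le Real.pi_pos.le] at hθ
    have := gciH_cos_mul_sin_pow m κ hθ
    linear_combination Real.cos θ * Real.exp (κ * Real.cos θ) * this
  rw [cTilde, hnum, hden]
  field_simp
  ring

/-- Treats the lower and upper bounds for `1 - c̃` together: `E` is the quotient of normalisations,
and `A`, `B` are `-1/3` or `0` according to whether the cubic term is present. None of these affects
the limit at this order. -/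
theorem tendsto_momentRatio_quotient (m : ℕ) (E : ℝ → ℝ)
    (hE : Tendsto (fun x => x * (E x - 1)) atTop (𝓝 0)) (A B : ℝ) :
    Tendsto (fun x => x * (x * (E x * (momentRatio m 1 x * (2 - momentRatio m 2 x / 3 +
        A * (momentRatio m 2 x * momentRatio m 3 x))) /
        (2 - momentRatio m 1 x / 3 + B * (momentRatio m 1 x * momentRatio m 2 x))) -
        (m + 3) / 2)) atTop (𝓝 ((m + 3) * (1 - m) / 8 - (m + 3) / 12)) := by
  have r1 := tendsto_momentRatio m 1
  have r2 := tendsto_momentRatio m 2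
  have r3 := tendsto_momentRatio m 3
  have l1 := tendsto_mul_momentRatio m 1
  have l2 := tendsto_mul_momentRatio m 2
  have q1 := tendsto_mul_mul_momentRatio_sub m 1
  have hE1 : Tendsto E atTop (𝓝 1) := by
    have h : Tendsto (fun x : ℝ => x⁻¹ * (x * (E x - 1)) + 1) atTop (𝓝 (0 * 0 + 1)) :=
      (tendsto_inv_atTop_zero.mul hE).add_const 1
    rw [mul_zero, zero_add] at h
    refine h.congr' ?_
    filter_upwards [eventually_ne_atTop 0] with x hx
    field_simp
    ring
  have hden : Tendsto (fun x => 2 - momentRatio m 1 x / 3 +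
      B * (momentRatio m 1 x * momentRatio m 2 x)) atTop (𝓝 (2 - 0 / 3 + B * (0 * 0))) :=
    (tendsto_const_nhds.sub (r1.div_const 3)).add ((r1.mul r2).const_mul B)
  have hnum := ((((q1.const_mul 2).add ((hE.mul l1).mul_const 2)).add
    ((hE1.mul l1).mul (((l2.div_const 3).neg).add ((l2.mul r3).const_mul A)))).sub
    (((l1.div_const 3).neg.add ((l1.mul r2).const_mul B)).const_mul ((m + 3 : ℝ) / 2)))
  have hden0 : (2 - 0 / 3 + B * (0 * 0) : ℝ) ≠ 0 := by norm_num
  refine ((hnum.div hden hden0).congr' ?_).trans (le_of_eq ?_)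
  · filter_upwards [hden.eventually_ne hden0] with x hx
    simp only [Pi.div_apply]
    have hq : ∀ N c d : ℝ, d ≠ 0 → x * (x * (N / d) - c) * d = x * (x * N - c * d) := by
      intro N c d hd
      field_simp
    rw [div_eq_iff hx, hq _ _ _ hx]
    push_cast
    ring
  · congr 1
    push_cast
    ring

theorem tendsto_mul_error (C : ℝ) (D : ℝ → ℝ) (hD : ∀ x, 0 < x → x ≤ D x) :
    Tendsto (fun x => x * (C / x / D x)) atTop (𝓝 0) := by
  have h : Tendsto (fun x => |C| / x) atTop (𝓝 0) := tendsto_const_nhds.div_atTop tendsto_id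
  refine squeeze_zero_norm' ?_ h
  filter_upwards [eventually_gt_atTop 0] with x hx
  have hDx := hD x hx
  have hD0 : 0 < D x := hx.trans_le hDx
  rw [show x * (C / x / D x) = C / D x by field_simp, Real.norm_eq_abs, abs_div, abs_of_pos hD0]
  gcongr

/-- Since `1 - c̃` is a quotient of two weighted moments, opposite bounds are used in numerator and
denominator. The normalisations satisfy `l' - l = O(1/x)`, so their quotient is `1 + O(x⁻²)` and
both bounds have the same limit. -/
theorem tendsto_mul_mul_one_sub_cTilde (m : ℕ) :
    Tendsto (fun x => x * (x * (1 - cTilde (m + 2) x) - (m + 3) / 2)) atTop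
      (𝓝 ((m + 3) * (1 - m) / 8 - (m + 3) / 12)) := by
  set l : ℝ → ℝ := fun x => x + 2 * m / 3 with hl
  set l' : ℝ → ℝ := fun x => x + 2 * m / 3 + (m + 2) ^ 2 / (6 * x) with hl'
  have hlx : ∀ x, 0 < x → x ≤ l x := fun x hx => by
    simp only [hl]
    have : (0 : ℝ) ≤ 2 * m / 3 := by positivity
    linarith
  have hlx' : ∀ x, 0 < x → l x ≤ l' x := fun x hx => by
    simp only [hl, hl']
    have : (0 : ℝ) ≤ (m + 2) ^ 2 / (6 * x) := by positivity
    linarith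
  have hup := tendsto_momentRatio_quotient m (fun x => l' x / l x)
    ((tendsto_mul_error ((m + 2) ^ 2 / 6) l hlx).congr' (by
      filter_upwards [eventually_gt_atTop 0] with x hx
      have := hx.trans_le (hlx x hx)
      have h2 : l' x = l x + (m + 2) ^ 2 / 6 / x := by
        simp only [hl, hl']
        rw [div_div]
      rw [h2]
      field_simp
      ring)) 0 (-1 / 3)
  have hlo := tendsto_momentRatio_quotient m (fun x => l x / l' x)
    ((tendsto_mul_error (-((m + 2) ^ 2 / 6)) l' fun x hx => (hlx x hx).trans (hlx' x hx)).congr'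
      (by
      filter_upwards [eventually_gt_atTop 0] with x hx
      have := (hx.trans_le (hlx x hx)).trans_le (hlx' x hx)
      have h2 : l x = l' x - (m + 2) ^ 2 / 6 / x := by
        simp only [hl, hl']
        rw [div_div]
        ring
      rw [h2]
      field_simp
      ring)) (-1 / 3) 0
  have r1 := tendsto_momentRatio m 1
  have r2 := tendsto_momentRatio m 2
  have key : ∀ᶠ x in atTop, l x / l' x * (momentRatio m 1 x * (2 - momentRatio m 2 x / 3 +
      (-1 / 3) * (momentRatio m 2 x * momentRatio m 3 x))) /
      (2 - momentRatio m 1 x / 3 + 0 * (momentRatio m 1 x * momentRatio m 2 x)) ≤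
      1 - cTilde (m + 2) x ∧ 1 - cTilde (m + 2) x ≤
      l' x / l x * (momentRatio m 1 x * (2 - momentRatio m 2 x / 3 +
      0 * (momentRatio m 2 x * momentRatio m 3 x))) /
      (2 - momentRatio m 1 x / 3 + (-1 / 3) * (momentRatio m 1 x * momentRatio m 2 x)) := by
    filter_upwards [eventually_gt_atTop 0, r1.eventually (gt_mem_nhds one_pos),
      r2.eventually (gt_mem_nhds one_pos)] with x hx h1 h2
    have hl0 : 0 < l x := hx.trans_le (hlx x hx)
    have hl0' : 0 < l' x := hl0.trans_le (hlx' x hx)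
    have hg := isGCI_gciG m hx
    have p1 := momentRatio_pos m 1 x
    have p2 := momentRatio_pos m 2 x
    have hM := moment_pos m 1 x
    have e2 : moment m 2 x = momentRatio m 1 x * moment m 1 x := moment_succ m 1 x
    have e3 : moment m 3 x = momentRatio m 2 x * moment m 2 x := moment_succ m 2 x
    have e4 : moment m 4 x = momentRatio m 3 x * moment m 3 x := moment_succ m 3 x
    have u0 : l x * gciMoment m x (gciG (m + 2) x) 0 ≤ 2 * moment m 1 x - moment m 2 x / 3 :=
      hg.gciMoment_le hx 0
    have u1 : l x * gciMoment m x (gciG (m + 2) x) 1 ≤ 2 * moment m 2 x - moment m 3 x / 3 :=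
      hg.gciMoment_le hx 1
    have v0 : 2 * moment m 1 x - moment m 2 x / 3 - moment m 3 x / 3 ≤
        l' x * gciMoment m x (gciG (m + 2) x) 0 := hg.le_gciMoment hx 0
    have v1 : 2 * moment m 2 x - moment m 3 x / 3 - moment m 4 x / 3 ≤
        l' x * gciMoment m x (gciG (m + 2) x) 1 := hg.le_gciMoment hx 1
    have hL0 : 0 < 2 * moment m 1 x - moment m 2 x / 3 - moment m 3 x / 3 := by
      rw [e3, e2]
      have : 0 < moment m 1 x * (2 - momentRatio m 1 x / 3 -
          momentRatio m 2 x * momentRatio m 1 x / 3) := mul_pos hM (by nlinarith)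
      linarith
    have hJ0 : 0 < gciMoment m x (gciG (m + 2) x) 0 :=
      pos_of_mul_pos_right (hL0.trans_le v0) hl0'.le
    rw [one_sub_cTilde_eq m hx hJ0.ne']
    have hU0 : 0 < 2 * moment m 1 x - moment m 2 x / 3 := (mul_pos hl0 hJ0).trans_le u0
    have d1 : 2 - momentRatio m 1 x / 3 + 0 * (momentRatio m 1 x * momentRatio m 2 x) =
        (2 * moment m 1 x - moment m 2 x / 3) / moment m 1 x := by
      rw [e2]
      field_simp
      ring
    have d2 : 2 - momentRatio m 1 x / 3 + (-1 / 3) * (momentRatio m 1 x * momentRatio m 2 x) =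
        (2 * moment m 1 x - moment m 2 x / 3 - moment m 3 x / 3) / moment m 1 x := by
      rw [e3, e2]
      field_simp
      ring
    have d3 : momentRatio m 1 x * (2 - momentRatio m 2 x / 3 +
        (-1 / 3) * (momentRatio m 2 x * momentRatio m 3 x)) =
        (2 * moment m 2 x - moment m 3 x / 3 - moment m 4 x / 3) / moment m 1 x := by
      rw [e4, e3, e2]
      field_simp
      ring
    have d4 : momentRatio m 1 x * (2 - momentRatio m 2 x / 3 +
        0 * (momentRatio m 2 x * momentRatio m 3 x)) =
        (2 * moment m 2 x - moment m 3 x / 3) / moment m 1 x := by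
      rw [e3, e2]
      field_simp
      ring
    rw [d1, d2, d3, d4, mul_div_assoc', mul_div_assoc', div_div_div_cancel_right₀ hM.ne',
      div_div_div_cancel_right₀ hM.ne']
    have hJ1 : 0 ≤ gciMoment m x (gciG (m + 2) x) 1 := by
      refine intervalIntegral.integral_nonneg Real.pi_pos.le fun θ hθ => ?_
      by_cases hθ' : θ ∈ Set.Ioo 0 Real.pi
      · have h0 := one_sub_cos_pos hθ'
        have hs := Real.sin_pos_of_mem_Ioo hθ'
        have := hg.nonneg hx hθ'
        positivity
      · have hs : Real.sin θ = 0 := by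
          by_contra hne
          refine hθ' ⟨lt_of_le_of_ne hθ.1 fun h => hne ?_, lt_of_le_of_ne hθ.2 fun h => hne ?_⟩
          · rw [← h, Real.sin_zero]
          · rw [h, Real.sin_pi]
        simp [hs]
    constructor
    · rw [div_le_div_iff₀ hU0 hJ0, div_mul_eq_mul_div, div_mul_eq_mul_div, div_le_iff₀ hl0']
      calc l x * (2 * moment m 2 x - moment m 3 x / 3 - moment m 4 x / 3) *
            gciMoment m x (gciG (m + 2) x) 0
          = (2 * moment m 2 x - moment m 3 x / 3 - moment m 4 x / 3) *
            (l x * gciMoment m x (gciG (m + 2) x) 0) := by ring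
        _ ≤ (l' x * gciMoment m x (gciG (m + 2) x) 1) *
            (2 * moment m 1 x - moment m 2 x / 3) := by
          refine mul_le_mul v1 u0 (by positivity) (by positivity)
        _ = _ := by ring
    · rw [div_le_div_iff₀ hJ0 hL0, div_mul_eq_mul_div, div_mul_eq_mul_div, le_div_iff₀ hl0]
      calc gciMoment m x (gciG (m + 2) x) 1 *
            (2 * moment m 1 x - moment m 2 x / 3 - moment m 3 x / 3) * l x
          = (l x * gciMoment m x (gciG (m + 2) x) 1) *
            (2 * moment m 1 x - moment m 2 x / 3 - moment m 3 x / 3) := by ring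
        _ ≤ (2 * moment m 2 x - moment m 3 x / 3) *
            (l' x * gciMoment m x (gciG (m + 2) x) 0) := by
          refine mul_le_mul u1 v0 hL0.le (le_trans (by positivity) u1)
        _ = _ := by ring
  refine tendsto_of_tendsto_of_tendsto_of_le_of_le' hlo hup ?_ ?_
  · filter_upwards [key, eventually_gt_atTop 0] with x hx hx0
    gcongr
    exact hx.1
  · filter_upwards [key, eventually_gt_atTop 0] with x hx hx0
    gcongr
    exact hx.2

/-- The first-order coefficients of `1 - c` and `1 - c̃` are `(m + 1)/2` and `(m + 3)/2`; their
difference `1` accounts for the added `x`. -/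
theorem tendsto_cTilde_sub_orderParam (m : ℕ) :
    Tendsto (fun x => x ^ 2 * (cTilde (m + 2) x - orderParam (m + 2) x) + x) atTop
      (𝓝 (m / 3)) := by
  refine (((tendsto_mul_mul_momentRatio_sub m 0).sub
    (tendsto_mul_mul_one_sub_cTilde m)).congr fun x => ?_).trans (le_of_eq ?_)
  · rw [orderParam_eq]
    push_cast
    ring
  · congr 1
    push_cast
    ring

/-! ### Hyperbolicity and the sign of `Θ` -/

theorem symbol_apply (n : ℕ) (κ : ℝ → ℝ) (ρ : ℝ) (Ω ξ : EuclideanSpace ℝ (Fin n))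
    (u : ℝ × (Submodule.span ℝ {Ω})ᗮ) :
    symbol n κ ρ Ω ξ u =
      (deriv (fun x => x * coeff1 n κ x) ρ * inner ℝ Ω ξ * u.1 +
        ρ * coeff1 n κ ρ * inner ℝ ξ (u.2 : EuclideanSpace ℝ (Fin n)),
      (coeff2 n κ ρ * inner ℝ Ω ξ) • u.2 +
        (Theta n κ ρ / ρ * u.1) • (Submodule.span ℝ {Ω})ᗮ.orthogonalProjectionOnto ξ) := rfl

theorem inner_orthogonalProjectionOnto_left {n : ℕ} (Ω ξ : EuclideanSpace ℝ (Fin n))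
    (w : (Submodule.span ℝ {Ω})ᗮ) :
    inner ℝ ξ (w : EuclideanSpace ℝ (Fin n)) =
      inner ℝ ((Submodule.span ℝ {Ω})ᗮ.orthogonalProjectionOnto ξ) w := by
  simp

/-- A block operator `(r, w) ↦ (A r + B ⟪p, w⟫, C w + D r p)` with `B D > 0` is diagonalizable
over the reals. -/
theorem iSup_eigenspace_eq_top_of_pos {E : Type*} [NormedAddCommGroup E] [InnerProductSpace ℝ E]
    (T : Module.End ℝ (ℝ × E)) (A B C D : ℝ) (p : E) (hBD : 0 < B * D)
    (hT : ∀ u : ℝ × E, T u = (A * u.1 + B * inner ℝ p u.2, C • u.2 + (D * u.1) • p)) :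
    ⨆ μ : ℝ, T.eigenspace μ = ⊤ := by
  have mem : ∀ (μ : ℝ) (v : ℝ × E), T v = μ • v → v ∈ ⨆ μ : ℝ, T.eigenspace μ := fun μ v h =>
    Submodule.mem_iSup_of_mem μ (Module.End.mem_eigenspace_iff.mpr h)
  have hperp : ∀ w : E, inner ℝ p w = 0 → ((0 : ℝ), w) ∈ ⨆ μ : ℝ, T.eigenspace μ := by
    intro w hw
    refine mem C _ ?_
    rw [hT]
    ext <;> simp [hw]
  rw [eq_top_iff]
  rintro ⟨r, w⟩ -
  by_cases hp : p = 0
  · have h1 : ((r : ℝ), (0 : E)) ∈ ⨆ μ : ℝ, T.eigenspace μ := by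
      refine mem A _ ?_
      rw [hT]
      ext <;> simp [hp]
    have := Submodule.add_mem _ h1 (hperp w (by simp [hp]))
    simpa using this
  have hpp : 0 < inner ℝ p p := by
    rw [real_inner_self_eq_norm_sq]
    positivity
  set P : ℝ := inner ℝ p p with hP
  have hD : D ≠ 0 := fun h => by simp [h] at hBD
  set q : ℝ := √((A - C) ^ 2 + 4 * (B * D * P)) with hq
  have hq2 : q ^ 2 = (A - C) ^ 2 + 4 * (B * D * P) := Real.sq_sqrt (by positivity)
  have hqpos : 0 < q := Real.sqrt_pos.mpr (by positivity)
  have heig : ∀ μ : ℝ, (μ - A) * (μ - C) = B * D * P →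
      ((μ - C : ℝ), D • p) ∈ ⨆ μ : ℝ, T.eigenspace μ := by
    intro μ hμ
    refine mem μ _ ?_
    rw [hT]
    ext
    · simp only [inner_smul_right, ← hP, Prod.smul_fst, smul_eq_mul]
      linear_combination -hμ
    · simp only [Prod.smul_snd, smul_smul, ← add_smul]
      congr 1
      ring
  -- The two roots of `(μ - A)(μ - C) = B D P` differ by `q > 0`, so the difference of their
  -- eigenvectors is `(q, 0)`.
  have h1 := heig ((A + C + q) / 2) (by linear_combination hq2 / 4)
  have h2 := heig ((A + C - q) / 2) (by linear_combination hq2 / 4)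
  have hr : ((1 : ℝ), (0 : E)) ∈ ⨆ μ : ℝ, T.eigenspace μ := by
    have := Submodule.smul_mem _ q⁻¹ (Submodule.sub_mem _ h1 h2)
    convert this using 1
    ext
    · simp only [Prod.smul_fst, Prod.fst_sub, smul_eq_mul]
      field_simp
      ring
    · simp
  have hpm : ((0 : ℝ), p) ∈ ⨆ μ : ℝ, T.eigenspace μ := by
    have := Submodule.smul_mem _ D⁻¹
      (Submodule.sub_mem _ h1 (Submodule.smul_mem _ ((A + C + q) / 2 - C) hr))
    convert this using 1
    ext
    · simp
    · simp [smul_smul, hD]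
  have hw : inner ℝ p (w - (inner ℝ p w / P) • p) = 0 := by
    rw [inner_sub_right, inner_smul_right, ← hP]
    field_simp
    ring
  have := Submodule.add_mem _ (Submodule.add_mem _ (Submodule.smul_mem _ r hr)
    (Submodule.smul_mem _ (inner ℝ p w / P) hpm)) (hperp _ hw)
  convert this using 1
  ext <;> simp

theorem isHyperbolicAt_of_pos {n : ℕ} {κ : ℝ → ℝ} {ρ : ℝ} (hρ : 0 < ρ)
    (hc : 0 < coeff1 n κ ρ) (hΘ : 0 < Theta n κ ρ) : IsHyperbolicAt n κ ρ := by
  intro Ω ξ _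
  refine iSup_eigenspace_eq_top_of_pos _ (deriv (fun x => x * coeff1 n κ x) ρ * inner ℝ Ω ξ)
    (ρ * coeff1 n κ ρ) (coeff2 n κ ρ * inner ℝ Ω ξ) (Theta n κ ρ / ρ)
    ((Submodule.span ℝ {Ω})ᗮ.orthogonalProjectionOnto ξ) (by positivity) fun u => ?_
  rw [symbol_apply, inner_orthogonalProjectionOnto_left]

theorem not_isHyperbolicAt_of_neg {n : ℕ} (hn : 2 ≤ n) {κ : ℝ → ℝ} {ρ : ℝ} (hρ : 0 < ρ)
    (hc : 0 < coeff1 n κ ρ) (hΘ : Theta n κ ρ < 0) : ¬ IsHyperbolicAt n κ ρ := by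
  intro h
  let Ω : EuclideanSpace ℝ (Fin n) := EuclideanSpace.single ⟨0, by omega⟩ 1
  let ξ : EuclideanSpace ℝ (Fin n) := EuclideanSpace.single ⟨1, by omega⟩ 1
  have hΩξ : inner ℝ Ω ξ = 0 := by
    simp [Ω, ξ, EuclideanSpace.inner_single_left]
  have hξ : ξ ∈ (Submodule.span ℝ {Ω})ᗮ := Submodule.mem_orthogonal_singleton_iff_inner_right.mpr hΩξ
  have htop := h Ω ξ (by simp [Ω])
  -- For `ξ ⊥ Ω` the diagonal blocks vanish, so an eigenvector satisfies `(μ² - c₁ Θ) r = 0` with a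
  -- positive factor; every real eigenvector has `r = 0`.
  have hle : ⨆ μ : ℝ, (symbol n κ ρ Ω ξ).eigenspace μ ≤
      LinearMap.ker (LinearMap.fst ℝ ℝ (Submodule.span ℝ {Ω})ᗮ) := by
    refine iSup_le fun μ u hu => ?_
    rw [Module.End.mem_eigenspace_iff, symbol_apply, hΩξ] at hu
    have e1 := congrArg Prod.fst hu
    have e2 := congrArg (fun v : ℝ × (Submodule.span ℝ {Ω})ᗮ => inner ℝ ξ (v.2 : EuclideanSpace ℝ (Fin n))) hu
    have hproj : ((Submodule.span ℝ {Ω})ᗮ.orthogonalProjectionOnto ξ : EuclideanSpace ℝ (Fin n)) = ξ :=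
      Submodule.starProjection_eq_self_iff.mpr hξ
    have hnorm : inner ℝ ξ ξ = (1 : ℝ) := by simp [ξ]
    simp only [mul_zero, zero_mul, zero_add, Prod.smul_fst, smul_eq_mul] at e1
    simp only [mul_zero, zero_smul, zero_add, Submodule.coe_smul, hproj, inner_smul_right, hnorm,
      mul_one, Prod.smul_snd] at e2
    have h3 : (μ ^ 2 - coeff1 n κ ρ * Theta n κ ρ) * u.1 = 0 := by
      have : ρ * (Theta n κ ρ / ρ * u.1) = Theta n κ ρ * u.1 := by field_simp
      linear_combination (-μ) * e1 - ρ * coeff1 n κ ρ * e2 + coeff1 n κ ρ * this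
    have h4 : 0 < μ ^ 2 - coeff1 n κ ρ * Theta n κ ρ := by nlinarith [sq_nonneg μ]
    exact (mul_eq_zero.mp h3).resolve_left h4.ne'
  rw [htop] at hle
  have : ((1 : ℝ), (0 : (Submodule.span ℝ {Ω})ᗮ)) ∈
      LinearMap.ker (LinearMap.fst ℝ ℝ (Submodule.span ℝ {Ω})ᗮ) := hle trivial
  simp at this

/-! ### The inverse of the ratio `k` -/

section Inverse

variable {ν τ : ℝ → ℝ}

theorem IsModel.continuousOn_ratio (hmodel : IsModel ν τ) : ContinuousOn (ratio ν τ) (Set.Ici 0) :=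
  hmodel.continuous_nu.div hmodel.continuous_tau fun s hs => (hmodel.tau_pos s hs).ne'

theorem IsModel.ratio_zero (hmodel : IsModel ν τ) : ratio ν τ 0 = 0 := by rw [ratio, hmodel.nu_zero, zero_div]

theorem IsModel.inverse_ratio (hmodel : IsModel ν τ) {s : ℝ} (hs : 0 ≤ s) : inverse (ratio ν τ) (ratio ν τ s) = s :=
  hmodel.ratio_increasing.injOn (Function.invFunOn_apply_mem hs) hs
    (Function.invFunOn_apply_eq hs)

/-- Surjectivity onto `[0, ∞)`, which makes `inverse` a genuine two-sided inverse there: `k` is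
continuous, vanishes at `0` and tends to infinity. -/
theorem IsModel.exists_ratio_eq (hmodel : IsModel ν τ)
    (htop : Tendsto (ratio ν τ) atTop atTop) {x : ℝ} (hx : 0 ≤ x) : ∃ s ∈ Set.Ici 0, ratio ν τ s = x := by
  obtain ⟨S, hS0, hS⟩ := ((eventually_ge_atTop 0).and (htop.eventually_ge_atTop x)).exists
  obtain ⟨s, hs, hsx⟩ := intermediate_value_Icc hS0
    (hmodel.continuousOn_ratio.mono Set.Icc_subset_Ici_self)
    (show x ∈ Set.Icc (ratio ν τ 0) (ratio ν τ S) from ⟨by rwa [hmodel.ratio_zero], hS⟩)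
  exact ⟨s, hs.1, hsx⟩

theorem IsModel.inverse_nonneg (hmodel : IsModel ν τ)
    (htop : Tendsto (ratio ν τ) atTop atTop) {x : ℝ} (hx : 0 ≤ x) : 0 ≤ inverse (ratio ν τ) x :=
  Function.invFunOn_mem (hmodel.exists_ratio_eq htop hx)

theorem IsModel.ratio_inverse (hmodel : IsModel ν τ)
    (htop : Tendsto (ratio ν τ) atTop atTop) {x : ℝ} (hx : 0 ≤ x) : ratio ν τ (inverse (ratio ν τ) x) = x :=
  Function.invFunOn_eq (hmodel.exists_ratio_eq htop hx)

theorem IsModel.inverse_strictMonoOn (hmodel : IsModel ν τ)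
    (htop : Tendsto (ratio ν τ) atTop atTop) : StrictMonoOn (inverse (ratio ν τ)) (Set.Ici 0) := by
  intro x hx y hy hxy
  rw [← hmodel.ratio_inverse htop hx, ← hmodel.ratio_inverse htop hy] at hxy
  exact (hmodel.ratio_increasing.lt_iff_lt (hmodel.inverse_nonneg htop hx)
    (hmodel.inverse_nonneg htop hy)).mp hxy

theorem IsModel.inverse_pos (hmodel : IsModel ν τ)
    (htop : Tendsto (ratio ν τ) atTop atTop) {x : ℝ} (hx : 0 < x) : 0 < inverse (ratio ν τ) x := by
  have h := hmodel.inverse_strictMonoOn htop Set.self_mem_Ici hx.le hx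
  exact (hmodel.inverse_nonneg htop le_rfl).trans_lt h

theorem IsModel.continuousAt_inverse (hmodel : IsModel ν τ)
    (htop : Tendsto (ratio ν τ) atTop atTop) {x : ℝ} (hx : 0 < x) :
    ContinuousAt (inverse (ratio ν τ)) x := by
  refine ((hmodel.inverse_strictMonoOn htop).mono
    Set.Ioi_subset_Ici_self).continuousAt_of_image_mem_nhds (Ioi_mem_nhds hx) ?_
  refine mem_of_superset (Ioi_mem_nhds (hmodel.inverse_pos htop hx)) fun s hs => ?_
  refine ⟨ratio ν τ s, ?_, hmodel.inverse_ratio (le_of_lt hs)⟩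
  have hs : 0 < s := hs
  have := hmodel.ratio_increasing Set.self_mem_Ici hs.le hs
  rwa [hmodel.ratio_zero] at this

theorem IsModel.tendsto_inverse (hmodel : IsModel ν τ)
    (htop : Tendsto (ratio ν τ) atTop atTop) : Tendsto (inverse (ratio ν τ)) atTop atTop := by
  refine tendsto_atTop.mpr fun S => ?_
  have h0 : 0 ≤ ratio ν τ (max S 0) := by
    have := hmodel.ratio_increasing.monotoneOn Set.self_mem_Ici
      (show max S 0 ∈ Set.Ici 0 from le_max_right S 0) (le_max_right S 0)
    rwa [hmodel.ratio_zero] at this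
  filter_upwards [eventually_ge_atTop (ratio ν τ (max S 0))] with x hx
  have := (hmodel.inverse_strictMonoOn htop).monotoneOn h0 (h0.trans hx) hx
  rw [hmodel.inverse_ratio (le_max_right S 0)] at this
  exact (le_max_left S 0).trans this

theorem IsModel.hasDerivAt_inverse (hmodel : IsModel ν τ)
    (htop : Tendsto (ratio ν τ) atTop atTop) {x : ℝ} (hx : 0 < x)
    (hd : deriv (ratio ν τ) (inverse (ratio ν τ) x) ≠ 0) :
    HasDerivAt (inverse (ratio ν τ)) (deriv (ratio ν τ) (inverse (ratio ν τ) x))⁻¹ x :=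
  HasDerivAt.of_local_left_inverse (hmodel.continuousAt_inverse htop hx)
    (differentiableAt_of_deriv_ne_zero hd).hasDerivAt hd (by
      filter_upwards [Ioi_mem_nhds hx] with y hy using hmodel.ratio_inverse htop (le_of_lt hy))

end Inverse

/-! ### Stable branches -/

section Branch

variable {m : ℕ} {k κ : ℝ → ℝ} {ρ₀ : ℝ}

/-- Stability alone makes `j / c` differentiable at `κ ρ`, because a nonzero `deriv` excludes the
default value; the inverse function rule then applies to the continuous branch. -/
theorem IsStableBranch.hasDerivAt (h : IsStableBranch (m + 2) k ρ₀ κ) {ρ : ℝ} (hρ : ρ₀ < ρ) :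
    HasDerivAt κ (deriv (fun x => inverse k x / orderParam (m + 2) x) (κ ρ))⁻¹ ρ := by
  have hs := (h.stable ρ hρ).ne'
  refine HasDerivAt.of_local_left_inverse (h.continuous.continuousAt (Ioi_mem_nhds hρ))
    (differentiableAt_of_deriv_ne_zero hs).hasDerivAt hs ?_
  filter_upwards [Ioi_mem_nhds hρ] with y hy using h.compatibility y hy

theorem IsStableBranch.strictMonoOn (h : IsStableBranch (m + 2) k ρ₀ κ) :
    StrictMonoOn κ (Set.Ioi ρ₀) := by
  refine strictMonoOn_of_deriv_pos (convex_Ioi ρ₀) h.continuous fun ρ hρ => ?_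
  rw [interior_Ioi] at hρ
  rw [(h.hasDerivAt hρ).deriv]
  exact inv_pos.mpr (h.stable ρ hρ)

/-- If `κ` stayed below `M`, the continuous function `j / c` would be bounded on `[κ (ρ₀ + 1), M]`,
although along the branch it equals `ρ`. -/
theorem IsStableBranch.tendsto (h : IsStableBranch (m + 2) k ρ₀ κ)
    (hj : ∀ x, 0 < x → ContinuousAt (inverse k) x) : Tendsto κ atTop atTop := by
  refine tendsto_atTop.mpr fun M => ?_
  suffices ∃ ρ₁, ρ₀ < ρ₁ ∧ M ≤ κ ρ₁ by
    obtain ⟨ρ₁, h1, h2⟩ := this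
    filter_upwards [eventually_ge_atTop ρ₁] with ρ hρ
    exact h2.trans (h.strictMonoOn.monotoneOn h1 (h1.trans_le hρ) hρ)
  by_contra! hM
  have hρ₁ : ρ₀ < ρ₀ + 1 := by linarith
  have hx₁ := h.pos _ hρ₁
  obtain ⟨B, hB⟩ := isCompact_Icc.exists_bound_of_continuousOn
    (f := fun x => inverse k x / orderParam (m + 2) x) (s := Set.Icc (κ (ρ₀ + 1)) M)
    fun x hx => by
      have hx0 : 0 < x := hx₁.trans_le hx.1
      exact ((hj x hx0).div (hasDerivAt_orderParam m x).continuousAt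
        (orderParam_pos m hx0).ne').continuousWithinAt
  have hmax : ρ₀ + 1 ≤ max (ρ₀ + 1) (B + 1) := le_max_left _ _
  have hgt : ρ₀ < max (ρ₀ + 1) (B + 1) := hρ₁.trans_le hmax
  have h1 := hB (κ (max (ρ₀ + 1) (B + 1)))
    ⟨h.strictMonoOn.monotoneOn hρ₁ hgt hmax, (hM _ hgt).le⟩
  rw [h.compatibility _ hgt, Real.norm_eq_abs] at h1
  have h2 := (le_abs_self _).trans h1
  have h3 := le_max_right (ρ₀ + 1) (B + 1)
  linarith

/-- The quantity whose sign is the sign of `Θ`. -/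
noncomputable def thetaNumerator (m : ℕ) (k : ℝ → ℝ) (x : ℝ) : ℝ :=
  deriv (inverse k) x / inverse k x - deriv (orderParam (m + 2)) x / orderParam (m + 2) x +
    (cTilde (m + 2) x - orderParam (m + 2) x)

theorem IsStableBranch.exists_Theta_eq (h : IsStableBranch (m + 2) k ρ₀ κ) {ρ : ℝ} (hρ : ρ₀ < ρ)
    (hj : 0 < inverse k (κ ρ)) (hjd : DifferentiableAt ℝ (inverse k) (κ ρ)) :
    ∃ P, 0 < P ∧ Theta (m + 2) κ ρ = P * thetaNumerator m k (κ ρ) := by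
  have hx := h.pos ρ hρ
  have hc := orderParam_pos m hx
  have hcd := (hasDerivAt_orderParam m (κ ρ)).differentiableAt
  have hst := h.stable ρ hρ
  have hF : deriv (fun x => inverse k x / orderParam (m + 2) x) (κ ρ) =
      ρ * (deriv (inverse k) (κ ρ) / inverse k (κ ρ) -
        deriv (orderParam (m + 2)) (κ ρ) / orderParam (m + 2) (κ ρ)) := by
    rw [show (fun x => inverse k x / orderParam (m + 2) x) = inverse k / orderParam (m + 2) from
      rfl, (hjd.hasDerivAt.div hcd.hasDerivAt hc.ne').deriv]
    have hcomp := h.compatibility ρ hρ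
    rw [div_eq_iff hc.ne'] at hcomp
    field_simp
    linear_combination (deriv (inverse k) (κ ρ) * orderParam (m + 2) (κ ρ) -
      inverse k (κ ρ) * deriv (orderParam (m + 2)) (κ ρ)) * hcomp
  set D := deriv (inverse k) (κ ρ) / inverse k (κ ρ) -
    deriv (orderParam (m + 2)) (κ ρ) / orderParam (m + 2) (κ ρ) with hD
  have hρ0 : 0 < ρ := h.nonneg.trans_lt hρ
  rw [hF] at hst
  have hD0 : 0 < D := pos_of_mul_pos_right hst hρ0.le
  refine ⟨1 / (κ ρ * D), by positivity, ?_⟩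
  rw [Theta, (h.hasDerivAt hρ).deriv, hF, thetaNumerator, ← hD]
  field_simp

end Branch

/-! ### Asymptotics of `Θ` -/

section Asymptotics

variable {k : ℝ → ℝ} {a b : ℝ}

/-- At `s = j(x)` this quotient is `x j'(x) / j(x)`. -/
theorem tendsto_div_mul_deriv (ha : 0 < a) (hb : 0 < b) (hk : k ~[atTop] fun s => a * s ^ b)
    (hk' : deriv k ~[atTop] fun s => a * b * s ^ (b - 1)) :
    Tendsto (fun s => k s / (s * deriv k s)) atTop (𝓝 (1 / b)) := by
  have h := hk.div ((IsEquivalent.refl (u := fun s : ℝ => s)).mul hk')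
  refine (isEquivalent_const_iff_tendsto (by positivity)).mp (h.congr_right ?_)
  filter_upwards [eventually_gt_atTop 0] with s hs
  have : s ^ b = s ^ (b - 1) * s := by
    rw [Real.rpow_sub_one hs.ne']
    field_simp
  have h2 : 0 < s ^ (b - 1) := by positivity
  simp only [Pi.div_apply, Pi.mul_apply, Function.const_apply, this]
  field_simp

theorem eventually_deriv_ne_zero (ha : 0 < a) (hb : 0 < b)
    (hk' : deriv k ~[atTop] fun s => a * b * s ^ (b - 1)) : ∀ᶠ s in atTop, deriv k s ≠ 0 := by
  have hne : ∀ᶠ s : ℝ in atTop, a * b * s ^ (b - 1) ≠ 0 := by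
    filter_upwards [eventually_gt_atTop 0] with s hs
    positivity
  have h := (isEquivalent_iff_tendsto_one hne).mp hk'
  filter_upwards [h.eventually_ne one_ne_zero] with s hs h0
  simp [h0] at hs

/-- The expression factors as `(k / (s k')) (k - s k')`, and `k - s k' = (k - a s - r) + r - s (k' -
a) → r`. -/
theorem tendsto_mul_sub_of_affine (hk : Tendsto (fun s => k s / (s * deriv k s)) atTop (𝓝 1))
    {r : ℝ} (h1 : (fun s => k s - (a * s + r)) =o[atTop] (fun _ => (1 : ℝ)))
    (h2 : (fun s => deriv k s - a) =o[atTop] (fun s => s⁻¹)) :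
    Tendsto (fun s => k s * (k s / (s * deriv k s)) - k s) atTop (𝓝 r) := by
  have e1 : Tendsto (fun s => k s - (a * s + r)) atTop (𝓝 0) := (isLittleO_one_iff ℝ).mp h1
  have e2 := h2.tendsto_div_nhds_zero
  have h := hk.mul ((e1.add_const r).sub e2)
  rw [zero_add, sub_zero, one_mul] at h
  refine h.congr' ?_
  filter_upwards [eventually_gt_atTop 0, hk.eventually_ne one_ne_zero] with s hs hne
  have hd : deriv k s ≠ 0 := fun h0 => by simp [h0] at hne
  field_simp
  ring

variable {ν τ : ℝ → ℝ} (m : ℕ)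

theorem IsModel.eventually_hasDerivAt_inverse (hmodel : IsModel ν τ)
    (htop : Tendsto (ratio ν τ) atTop atTop) (hne : ∀ᶠ s in atTop, deriv (ratio ν τ) s ≠ 0) :
    ∀ᶠ x in atTop, HasDerivAt (inverse (ratio ν τ))
      (deriv (ratio ν τ) (inverse (ratio ν τ) x))⁻¹ x := by
  filter_upwards [eventually_gt_atTop 0, (hmodel.tendsto_inverse htop).eventually hne]
    with x hx hd using hmodel.hasDerivAt_inverse htop hx hd

theorem IsModel.eventually_mul_deriv_inverse_div (hmodel : IsModel ν τ)
    (htop : Tendsto (ratio ν τ) atTop atTop) (hne : ∀ᶠ s in atTop, deriv (ratio ν τ) s ≠ 0) :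
    ∀ᶠ x in atTop, ratio ν τ (inverse (ratio ν τ) x) / (inverse (ratio ν τ) x *
        deriv (ratio ν τ) (inverse (ratio ν τ) x)) =
      x * (deriv (inverse (ratio ν τ)) x / inverse (ratio ν τ) x) := by
  filter_upwards [eventually_gt_atTop 0, hmodel.eventually_hasDerivAt_inverse htop hne]
    with x hx hd
  rw [hd.deriv, hmodel.ratio_inverse htop hx.le, div_eq_mul_inv, mul_inv]
  ring

/-- At this order `c'/c` is negligible, and `x (c̃ - c) → -1`. -/
theorem IsModel.tendsto_mul_thetaNumerator (hmodel : IsModel ν τ)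
    (htop : Tendsto (ratio ν τ) atTop atTop) (hne : ∀ᶠ s in atTop, deriv (ratio ν τ) s ≠ 0)
    (h : Tendsto (fun s => ratio ν τ s / (s * deriv (ratio ν τ) s)) atTop (𝓝 (1 / b))) :
    Tendsto (fun x => x * thetaNumerator m (ratio ν τ) x) atTop (𝓝 (1 / b - 1)) := by
  have hj := (h.comp (hmodel.tendsto_inverse htop)).congr'
    (hmodel.eventually_mul_deriv_inverse_div htop hne)
  have hinv := tendsto_inv_atTop_zero (𝕜 := ℝ)
  have hc := ((tendsto_sq_mul_deriv_orderParam m).mul hinv).div (tendsto_orderParam m) one_ne_zero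
  have hct := ((tendsto_cTilde_sub_orderParam m).mul hinv).sub_const 1
  refine (((hj.sub hc).add hct).congr' ?_).trans (le_of_eq ?_)
  · filter_upwards [eventually_gt_atTop 0] with x hx
    have := orderParam_pos m hx
    simp only [Pi.div_apply, thetaNumerator]
    field_simp
    ring
  · congr 1
    ring

theorem IsModel.tendsto_sq_mul_thetaNumerator (hmodel : IsModel ν τ)
    (htop : Tendsto (ratio ν τ) atTop atTop) (hne : ∀ᶠ s in atTop, deriv (ratio ν τ) s ≠ 0)
    {r : ℝ} (h : Tendsto (fun s => ratio ν τ s * (ratio ν τ s / (s * deriv (ratio ν τ) s)) -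
      ratio ν τ s) atTop (𝓝 r)) :
    Tendsto (fun x => x ^ 2 * thetaNumerator m (ratio ν τ) x) atTop (𝓝 (r - (m + 3) / 6)) := by
  have hj := h.comp (hmodel.tendsto_inverse htop)
  have hc := (tendsto_sq_mul_deriv_orderParam m).div (tendsto_orderParam m) one_ne_zero
  refine (((hj.sub hc).add (tendsto_cTilde_sub_orderParam m)).congr' ?_).trans (le_of_eq ?_)
  · filter_upwards [eventually_gt_atTop 0, hmodel.eventually_mul_deriv_inverse_div htop hne]
      with x hx he
    simp only [Function.comp_apply, Pi.div_apply, thetaNumerator]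
    rw [he, hmodel.ratio_inverse htop hx.le]
    ring
  · congr 1
    ring

theorem eventually_Theta_eq {κ : ℝ → ℝ} {ρ₀ : ℝ} (hmodel : IsModel ν τ)
    (htop : Tendsto (ratio ν τ) atTop atTop) (hne : ∀ᶠ s in atTop, deriv (ratio ν τ) s ≠ 0)
    (hbranch : IsStableBranch (m + 2) (ratio ν τ) ρ₀ κ) :
    ∀ᶠ ρ in atTop, ∃ P, 0 < P ∧
      Theta (m + 2) κ ρ = P * thetaNumerator m (ratio ν τ) (κ ρ) := by
  have hκ := hbranch.tendsto fun x hx => hmodel.continuousAt_inverse htop hx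
  filter_upwards [eventually_gt_atTop ρ₀,
    hκ.eventually (hmodel.eventually_hasDerivAt_inverse htop hne)] with ρ hρ hd
  exact hbranch.exists_Theta_eq hρ (hmodel.inverse_pos htop (hbranch.pos ρ hρ))
    hd.differentiableAt

end Asymptotics

end SOH

theorem mainTheorem12 (n : ℕ) (hn : 2 ≤ n) (ν τ : ℝ → ℝ) (hmodel : SOH.IsModel ν τ)
    (ρ₀ : ℝ) (κ : ℝ → ℝ) (hbranch : SOH.IsStableBranch n (SOH.ratio ν τ) ρ₀ κ)
    (a b : ℝ) (ha : 0 < a) (hb : 0 < b)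
    (hk : SOH.ratio ν τ ~[atTop] fun s => a * s ^ b)
    (hk' : deriv (SOH.ratio ν τ) ~[atTop] fun s => a * b * s ^ (b - 1)) :
    (b < 1 → ∀ᶠ ρ in atTop, 0 < SOH.Theta n κ ρ ∧ SOH.IsHyperbolicAt n κ ρ) ∧
    (1 < b → ∀ᶠ ρ in atTop, SOH.Theta n κ ρ < 0 ∧ ¬ SOH.IsHyperbolicAt n κ ρ) ∧
    (b = 1 → ∀ r : ℝ,
      (fun s => SOH.ratio ν τ s - (a * s + r)) =o[atTop] (fun _ => (1 : ℝ)) →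
      (fun s => deriv (SOH.ratio ν τ) s - a) =o[atTop] (fun s => s⁻¹) →
      r ≠ ((n : ℝ) + 1) / 6 →
      ∀ᶠ ρ in atTop,
        SignType.sign (SOH.Theta n κ ρ) = SignType.sign (r - ((n : ℝ) + 1) / 6)) := by
  obtain ⟨m, rfl⟩ : ∃ m, n = m + 2 := ⟨n - 2, by omega⟩
  have htop : Tendsto (SOH.ratio ν τ) atTop atTop :=
    hk.symm.tendsto_atTop ((tendsto_rpow_atTop hb).const_mul_atTop ha)
  have hne := SOH.eventually_deriv_ne_zero ha hb hk'
  have hquot := SOH.tendsto_div_mul_deriv ha hb hk hk'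
  have hκ := hbranch.tendsto fun x hx => hmodel.continuousAt_inverse htop hx
  have hΘ := SOH.eventually_Theta_eq m hmodel htop hne hbranch
  have hN := hmodel.tendsto_mul_thetaNumerator m htop hne hquot
  have hc : ∀ ρ, ρ₀ < ρ → 0 < SOH.coeff1 (m + 2) κ ρ := fun ρ hρ =>
    SOH.orderParam_pos m (hbranch.pos ρ hρ)
  refine ⟨fun hb1 => ?_, fun hb1 => ?_, fun hb1 r h1 h2 hr => ?_⟩
  · have hpos : 0 < 1 / b - 1 := by
      rw [sub_pos, lt_div_iff₀ hb]
      linarith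
    filter_upwards [hΘ, eventually_gt_atTop ρ₀, hκ.eventually (hN.eventually (lt_mem_nhds hpos))]
      with ρ ⟨P, hP, hρΘ⟩ hρ hNρ
    have h : 0 < SOH.Theta (m + 2) κ ρ := by
      rw [hρΘ]
      exact mul_pos hP (pos_of_mul_pos_right hNρ (hbranch.pos ρ hρ).le)
    exact ⟨h, SOH.isHyperbolicAt_of_pos (hbranch.nonneg.trans_lt hρ) (hc ρ hρ) h⟩
  · have hneg : 1 / b - 1 < 0 := by
      rw [sub_neg, div_lt_iff₀ hb]
      linarith
    filter_upwards [hΘ, eventually_gt_atTop ρ₀, hκ.eventually (hN.eventually (gt_mem_nhds hneg))]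
      with ρ ⟨P, hP, hρΘ⟩ hρ hNρ
    have h : SOH.Theta (m + 2) κ ρ < 0 := by
      rw [hρΘ]
      exact mul_neg_of_pos_of_neg hP (neg_of_mul_neg_right hNρ (hbranch.pos ρ hρ).le)
    exact ⟨h, SOH.not_isHyperbolicAt_of_neg hn (hbranch.nonneg.trans_lt hρ) (hc ρ hρ) h⟩
  · subst hb1
    rw [div_one] at hquot
    have hN2 := hmodel.tendsto_sq_mul_thetaNumerator m htop hne
      (SOH.tendsto_mul_sub_of_affine hquot h1 h2)
    have hlim : (((m + 2 : ℕ) : ℝ) + 1) / 6 = (m + 3) / 6 := by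
      push_cast
      ring
    rw [hlim] at hr ⊢
    -- Both signs are treated at once: the limit multiplied by itself is positive, so eventually the
    -- numerator has the sign of its limit.
    have key : ∀ᶠ ρ in atTop, 0 < (r - (m + 3) / 6) *
        SOH.thetaNumerator m (SOH.ratio ν τ) (κ ρ) := by
      have h := hN2.const_mul (r - (m + 3) / 6)
      have hsq : 0 < (r - (m + 3) / 6) * (r - (m + 3) / 6) :=
        mul_self_pos.mpr (sub_ne_zero.mpr hr)
      filter_upwards [hκ.eventually (h.eventually (lt_mem_nhds hsq))] with ρ hρ
      refine pos_of_mul_pos_right (a := κ ρ ^ 2) ?_ (sq_nonneg _)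
      linarith
    filter_upwards [hΘ, key] with ρ ⟨P, hP, hρΘ⟩ hρ
    rw [hρΘ, sign_mul, sign_pos hP, one_mul]
    rcases pos_and_pos_or_neg_and_neg_of_mul_pos hρ with ⟨h3, h4⟩ | ⟨h3, h4⟩
    · rw [sign_pos h3, sign_pos h4]
    · rw [sign_neg h3, sign_neg h4]
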